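/- For $x\in\mathbb R^n$ write $\langle x\rangle=(1+|x|^2)^{1/2}$. Fix a Schwartz function $\phi\in\mathcal S(\mathbb R^n)\setminus\{0\}$ and, for a tempered distribution $f\in\mathcal S'(\mathbb R^n)$, let $$V_\phi f(x,\xi)=\langle f,M_\xi T_x\phi\rangle=\int_{\mathbb R^n}f(t)\,\overline{\phi(t-x)}\,e^{-it\cdot\xi}\,dt$$ be its short-time Fourier transform (the integral being understood as the duality pairing of $f$ with the Schwartz function $t\mapsto\overline{\phi(t-x)}e^{-it\cdot\xi}$). For $1\le p<\infty$ and $s\ge 0$ the modulation space $M^{p,1}_s(\mathbb R^n)$ is the set of all $f\in\mathcal S'(\mathbb R^n)$ with $$\|f\|_{M^{p,1}_s}=\int_{\mathbb R^n}\langle\xi\rangle^{s}\Big(\int_{\mathbb R^n}|V_\phi f(x,\xi)|^p\,dx\Big)^{1/p}d\xi<\infty .$$ **Theorem.** Let $1\le p<\infty$, $s\ge 0$ and $f\in M^{p,1}_s(\mathbb R^n)$. Then the tempered distribution $f$ is given by integration against a unique continuous function $\mathbb R^n\to\mathbb C$, again denoted by $f$. Moreover, if $U\subset\mathbb C$ is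 an open set with $f(\mathbb R^n)\cup\{0\}\subset U$, and $F$ is a complex-valued function that is (complex) analytic on $U$ with $F(0)=0$, then there exists $g\in M^{p,1}_s(\mathbb R^n)$ such that $g(x)=F(f(x))$ for all $x\in\mathbb R^n$; that is, $F\circ f$ is continuous and the tempered distribution given by integration against it belongs to $M^{p,1}_s(\mathbb R^n)$. -/

import Mathlib

open MeasureTheory
open scoped SchwartzMap ENNReal ComplexConjugate

namespace ModulationSpace

/-- `ℝⁿ` with its Euclidean structure. -/
abbrev Rn (n : ℕ) : Type := EuclideanSpace ℝ (Fin n)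

/-- The Japanese bracket `⟨x⟩ = (1 + |x|²)^{1/2}`. -/
noncomputable def bracket {n : ℕ} (x : Rn n) : ℝ := Real.sqrt (1 + ‖x‖ ^ 2)

/-- The oscillating factor `t ↦ e^{-i t·ξ}`. -/
noncomputable def expNeg {n : ℕ} (ξ : Rn n) (t : Rn n) : ℂ :=
  Complex.exp (-(Complex.I * ((inner ℝ t ξ : ℝ) : ℂ)))

theorem hasTemperateGrowth_expNeg {n : ℕ} (ξ : Rn n) :
    (expNeg ξ).HasTemperateGrowth := by
  have h1 : (fun u : ℝ => Complex.exp (-Complex.I * (u : ℂ))).HasTemperateGrowth := by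
    have hd : ∀ m : ℕ, iteratedDeriv m (fun u : ℝ => Complex.exp (-Complex.I * (u : ℂ))) =
        fun u : ℝ => (-Complex.I) ^ m * Complex.exp (-Complex.I * (u : ℂ)) := by
      intro m
      induction m with
      | zero => simp
      | succ k ih =>
        rw [iteratedDeriv_succ, ih]
        funext u
        have h := (((Complex.ofRealCLM.hasDerivAt (x := u)).const_mul (-Complex.I)).cexp).const_mul
          ((-Complex.I) ^ k)
        simp only [Complex.ofRealCLM_apply, Complex.ofReal_one, mul_one] at h
        rw [h.deriv]
        ring
    refine ⟨?_, fun m => ⟨0, 1, fun u => ?_⟩⟩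
    · have : ContDiff ℝ ((⊤ : ℕ∞) : WithTop ℕ∞) (fun u : ℝ => (u : ℂ)) := Complex.ofRealCLM.contDiff
      fun_prop
    · rw [norm_iteratedFDeriv_eq_norm_iteratedDeriv, hd]
      simp [Complex.norm_exp]
  have h2 : (fun t : Rn n => inner ℝ t ξ).HasTemperateGrowth := by fun_prop
  have h3 := h1.comp h2
  have h4 : expNeg ξ = (fun u : ℝ => Complex.exp (-Complex.I * (u : ℂ))) ∘
      (fun t : Rn n => inner ℝ t ξ) := by
    funext t
    simp [expNeg]
  rw [h4]
  exact h3

/-- The Schwartz function `t ↦ conj (M_ξ T_x φ (t)) = e^{-i t·ξ} * conj (φ (t - x))`. -/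
noncomputable def conjAtom {n : ℕ} (φ : 𝓢(Rn n, ℂ)) (x ξ : Rn n) : 𝓢(Rn n, ℂ) :=
  SchwartzMap.smulLeftCLM ℂ (expNeg ξ)
    (SchwartzMap.postcompCLM (𝕜 := ℝ) (Complex.conjCLE : ℂ →L[ℝ] ℂ)
      (SchwartzMap.compSubConstCLM ℂ x φ))

theorem conjAtom_apply {n : ℕ} (φ : 𝓢(Rn n, ℂ)) (x ξ t : Rn n) :
    conjAtom φ x ξ t =
      Complex.exp (-(Complex.I * ((inner ℝ t ξ : ℝ) : ℂ))) * conj (φ (t - x)) := by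
  simp [conjAtom, hasTemperateGrowth_expNeg, expNeg]

/-- The short-time Fourier transform `V_φ f (x, ξ) = ⟨f, M_ξ T_x φ⟩` of a tempered distribution
`f` with window `φ`, where the pairing is antilinear in the second slot; formally it is
`∫ f(t) * conj (φ (t - x)) * e^{-i t·ξ} dt`. -/
noncomputable def stft {n : ℕ} (φ : 𝓢(Rn n, ℂ)) (f : 𝓢'(Rn n, ℂ)) (x ξ : Rn n) : ℂ :=
  f (conjAtom φ x ξ)

/-- The modulation space norm
`‖ f ‖ = ‖ ξ ↦ ⟨ξ⟩^s ‖ V_φ f (·, ξ) ‖_{L^p} ‖_{L^q}`, computed with the window `φ` and with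
values in `[0, ∞]`. -/
noncomputable def modNorm {n : ℕ} (φ : 𝓢(Rn n, ℂ)) (p q : ℝ≥0∞) (s : ℝ)
    (f : 𝓢'(Rn n, ℂ)) : ℝ≥0∞ :=
  eLpNorm (fun ξ : Rn n =>
    ENNReal.ofReal (bracket ξ ^ s) * eLpNorm (fun x : Rn n => stft φ f x ξ) p volume) q volume

/-- The modulation space `M^{p,q}_s(ℝⁿ)`, defined with the window `φ`. -/
def modulationSpace {n : ℕ} (φ : 𝓢(Rn n, ℂ)) (p q : ℝ≥0∞) (s : ℝ) : Set 𝓢'(Rn n, ℂ) :=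
  {f | modNorm φ p q s f < ∞}

/-- The tempered distribution `f` is (given by integration against) the continuous
function `u`. -/
def IsContinuousFunction {n : ℕ} (f : 𝓢'(Rn n, ℂ)) (u : Rn n → ℂ) : Prop :=
  Continuous u ∧ ∀ ψ : 𝓢(Rn n, ℂ),
    Integrable (fun t => u t * ψ t) volume ∧ f ψ = ∫ t, u t * ψ t

end ModulationSpace

/-! The inversion formula for the short-time Fourier transform writes f as c⁻¹ ∬ W(x, η) φ(t - x)
e^{2πi t·η} dx dη, where W is the transform of f in the frequency normalisation of `atom` and c =
‖φ‖₂² (`isContinuousFunction_synth`). Hölder in x against the decaying window, together with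
integrability in η (the exponent q = 1), makes this integral absolutely convergent. So f is a
bounded continuous function u, and since p < ∞ it vanishes at infinity (`tendsto_synth_cocompact`).
Hence K = u(ℝⁿ) ∪ {0} is a compact subset of U.

Two kinds of functions multiply M^{p,1}_s boundedly: C^N functions with bounded derivatives, N > n +
⌈s⌉ (`exists_mNorm_mul_contDiff_le`), and functions synthesised from some W of finite mixed norm
(`exists_mNorm_mul_synth_le`). Both follow from one principle (`mNorm_stftFun_mul_le`): if the
localised Fourier transforms of h have an envelope M, then the transform of gh is dominated by that
of g convolved with an integrable kernel in position and with M in frequency. Minkowski's inequality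
and submultiplicativity of the weight then finish the estimate.

For the composition, write F(z) = z G(z) and split u = b + v by a frequency cutoff
(`exists_synth_decomposition`). Here b has bounded frequencies, hence is smooth with bounded
derivatives, while v has small norm and small supremum. Taylor expansion around b(t) gives F(u) = ∑ₖ
(u vᵏ) · G⁽ᵏ⁾(b)/k!. The factor u vᵏ has norm at most (ρ/4)ᵏ times that of u
(`mNorm_mul_synth_pow_le`). By Cauchy's estimates, G⁽ᵏ⁾(b)/k! has C^N size O((2/ρ)ᵏ)
(`exists_taylorCoeff_comp_le`). The norms of the terms are therefore bounded by a geometric series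
of ratio 1/2 (`mNorm_stftFun_comp_lt_top`). -/

namespace ModulationSpace

open scoped FourierTransform

/-! ### Integral inequalities of Jensen, Minkowski and Hölder for `ℝ≥0∞`-valued functions -/

section Lebesgue

variable {X Q : Type*} [MeasurableSpace X] [MeasurableSpace Q]

/-- A weighted form of Jensen's inequality. -/
theorem lintegral_rpow_le_weighted {μ : Measure Q} {r : ℝ} (hr : 1 ≤ r) {f l : Q → ℝ≥0∞}
    (hf : AEMeasurable f μ) (hl : AEMeasurable l μ) (h0 : ∀ᵐ q ∂μ, l q = 0 → f q = 0)
    (htop : ∀ᵐ q ∂μ, l q ≠ ∞) :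
    (∫⁻ q, f q ∂μ) ^ r ≤ (∫⁻ q, l q ∂μ) ^ (r - 1) * ∫⁻ q, l q ^ (1 - r) * f q ^ r ∂μ := by
  rcases hr.eq_or_lt with rfl | hr
  · simp
  have hr0 : 0 < r := by linarith
  have hc : r.HolderConjugate (r / (r - 1)) := Real.HolderConjugate.conjExponent hr
  -- Hölder applied to the factorisation f = (l^((1-r)/r) f) · l^((r-1)/r), which is legitimate
  -- because f vanishes where l does.
  have h1 : ∫⁻ q, f q ∂μ ≤
      ∫⁻ q, ((fun q => l q ^ ((1 - r) / r) * f q) * fun q => l q ^ ((r - 1) / r)) q ∂μ := by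
    apply lintegral_mono_ae
    filter_upwards [h0, htop] with q hq0 hqt
    simp only [Pi.mul_apply]
    by_cases hz : l q = 0
    · simp [hq0 hz]
    · rw [mul_right_comm, ← ENNReal.rpow_add _ _ hz hqt,
        show (1 - r) / r + (r - 1) / r = 0 by ring]
      simp
  have h2 := ENNReal.lintegral_mul_le_Lp_mul_Lq μ hc
    (f := fun q => l q ^ ((1 - r) / r) * f q) (g := fun q => l q ^ ((r - 1) / r))
    ((hl.pow_const _).mul hf) (hl.pow_const _)
  have h3 := h1.trans h2
  have h4 : ∀ q, (l q ^ ((1 - r) / r) * f q) ^ r = l q ^ (1 - r) * f q ^ r := fun q => by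
    rw [ENNReal.mul_rpow_of_nonneg _ _ hr0.le, ← ENNReal.rpow_mul, div_mul_cancel₀ _ hr0.ne']
  have h5 : ∀ q, (l q ^ ((r - 1) / r)) ^ (r / (r - 1)) = l q := fun q => by
    rw [← ENNReal.rpow_mul, div_mul_div_cancel₀ hr0.ne', div_self (by linarith), ENNReal.rpow_one]
  simp only [h4, h5] at h3
  calc (∫⁻ q, f q ∂μ) ^ r
      ≤ ((∫⁻ q, l q ^ (1 - r) * f q ^ r ∂μ) ^ (1 / r) *
          (∫⁻ q, l q ∂μ) ^ (1 / (r / (r - 1)))) ^ r := ENNReal.rpow_le_rpow h3 hr0.le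
    _ = _ := by
      rw [ENNReal.mul_rpow_of_nonneg _ _ hr0.le, ← ENNReal.rpow_mul, ← ENNReal.rpow_mul, mul_comm]
      congr 2
      · field_simp
      · rw [one_div_mul_cancel hr0.ne', ENNReal.rpow_one]

/-- Minkowski's integral inequality. -/
theorem eLpNorm_lintegral_le {μ : Measure Q} {ν : Measure X} [SFinite μ] [SFinite ν]
    {p : ℝ≥0∞} (hp : 1 ≤ p) (hpt : p ≠ ∞) {F : X → Q → ℝ≥0∞}
    (hF : Measurable (Function.uncurry F)) :
    eLpNorm (fun x => ∫⁻ q, F x q ∂μ) p ν ≤ ∫⁻ q, eLpNorm (fun x => F x q) p ν ∂μ := by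
  have hp0 : p ≠ 0 := (zero_lt_one.trans_le hp).ne'
  have hr : 1 ≤ p.toReal := by
    have := ENNReal.toReal_mono hpt hp
    simpa using this
  have hr0 : 0 < p.toReal := by linarith
  set r := p.toReal with hrdef
  have hFr : Measurable (Function.uncurry fun x q => F x q ^ r) := hF.pow_const r
  set l : Q → ℝ≥0∞ := fun q => eLpNorm (fun x => F x q) p ν with hl
  have hl' : ∀ q, l q = (∫⁻ x, F x q ^ r ∂ν) ^ (1 / r) := fun q => by
    simp only [hl, eLpNorm_eq_lintegral_rpow_enorm_toReal hp0 hpt, enorm_eq_self]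
    rfl
  have hlr : ∀ q, l q ^ r = ∫⁻ x, F x q ^ r ∂ν := fun q => by
    rw [hl', ← ENNReal.rpow_mul, one_div_mul_cancel hr0.ne', ENNReal.rpow_one]
  have hlm : Measurable l := by
    have : l = fun q => (∫⁻ x, F x q ^ r ∂ν) ^ (1 / r) := funext hl'
    rw [this]
    exact (Measurable.lintegral_prod_left' hFr).pow_const _
  by_cases hfin : ∫⁻ q, l q ∂μ = ∞
  · rw [hfin]; exact le_top
  have htop : ∀ᵐ q ∂μ, l q ≠ ∞ := (ae_lt_top hlm hfin).mono fun q h => h.ne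
  -- A vanishing L^p norm forces F(·, q) = 0 almost everywhere. Exchanging the two almost-everywhere
  -- quantifiers gives the form that the weighted Jensen inequality needs for each x.
  have hzero : ∀ᵐ x ∂ν, ∀ᵐ q ∂μ, l q = 0 → F x q = 0 := by
    rw [Measure.ae_ae_comm]
    · refine Filter.Eventually.of_forall fun q => ?_
      by_cases hq : l q = 0
      · have h1 : ∫⁻ x, F x q ^ r ∂ν = 0 := by rw [← hlr, hq, ENNReal.zero_rpow_of_pos hr0]
        have hmx : Measurable fun x => F x q ^ r := hFr.comp measurable_prodMk_right
        rw [lintegral_eq_zero_iff hmx] at h1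
        filter_upwards [h1] with x hx _
        simpa [hr0, hr0.le, hr0.not_gt] using hx
      · exact Filter.Eventually.of_forall fun x h => absurd h hq
    · have : {z : X × Q | l z.2 = 0 → F z.1 z.2 = 0} =
          {z | l z.2 = 0}ᶜ ∪ {z | Function.uncurry F z = 0} := by
        ext z; simp [Function.uncurry, imp_iff_not_or]
      rw [this]
      exact ((hlm.comp measurable_snd) (measurableSet_singleton 0)).compl.union
        (hF (measurableSet_singleton 0))
  rw [eLpNorm_eq_lintegral_rpow_enorm_toReal hp0 hpt]
  simp only [enorm_eq_self, ← hrdef]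
  -- Jensen with the weight l(q) = ‖F(·, q)‖_p replaces duality: after Tonelli the inner integral is
  -- l^(1-r) l^r = l.
  have key : ∫⁻ x, (∫⁻ q, F x q ∂μ) ^ r ∂ν ≤ (∫⁻ q, l q ∂μ) ^ r := by
    calc ∫⁻ x, (∫⁻ q, F x q ∂μ) ^ r ∂ν
        ≤ ∫⁻ x, (∫⁻ q, l q ∂μ) ^ (r - 1) * ∫⁻ q, l q ^ (1 - r) * F x q ^ r ∂μ ∂ν := by
          apply lintegral_mono_ae
          filter_upwards [hzero] with x hx
          exact lintegral_rpow_le_weighted hr (hF.comp measurable_prodMk_left).aemeasurable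
            hlm.aemeasurable hx htop
      _ = (∫⁻ q, l q ∂μ) ^ (r - 1) * ∫⁻ q, l q ^ (1 - r) * l q ^ r ∂μ := by
          have hm : Measurable (Function.uncurry fun x q => l q ^ (1 - r) * F x q ^ r) :=
            ((hlm.comp measurable_snd).pow_const _).mul hFr
          have hmx : Measurable fun x => ∫⁻ q, l q ^ (1 - r) * F x q ^ r ∂μ :=
            Measurable.lintegral_prod_right' hm
          rw [lintegral_const_mul _ hmx, lintegral_lintegral_swap hm.aemeasurable]
          congr 2
          funext q
          have hmq : Measurable fun x => F x q ^ r := hFr.comp measurable_prodMk_right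
          rw [lintegral_const_mul _ hmq, hlr]
      _ ≤ (∫⁻ q, l q ∂μ) ^ (r - 1) * ∫⁻ q, l q ∂μ := by
          refine mul_le_mul_right ?_ _
          apply lintegral_mono_ae
          filter_upwards [htop] with q hq
          by_cases hz : l q = 0
          · simp [hz, hr0]
          · rw [← ENNReal.rpow_add _ _ hz hq]; simp
      _ = (∫⁻ q, l q ∂μ) ^ r := by
          nth_rewrite 2 [← ENNReal.rpow_one (∫⁻ q, l q ∂μ)]
          rw [← ENNReal.rpow_add_of_nonneg _ _ (by linarith) zero_le_one]
          simp
  calc (∫⁻ x, (∫⁻ q, F x q ∂μ) ^ r ∂ν) ^ (1 / r) ≤ ((∫⁻ q, l q ∂μ) ^ r) ^ (1 / r) :=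
        ENNReal.rpow_le_rpow key (by positivity)
    _ = _ := by rw [← ENNReal.rpow_mul, mul_one_div_cancel hr0.ne', ENNReal.rpow_one]

/-- Jensen with k itself as weight. Keeping k on the right allows k to be moved to infinity by
dominated convergence in `tendsto_synth_cocompact`. -/
theorem lintegral_mul_rpow_le {ν : Measure X} {r : ℝ} (hr : 1 ≤ r) {f k : X → ℝ≥0∞}
    (hf : Measurable f) (hk : Measurable k) (hk1 : ∀ x, k x ≤ 1) :
    (∫⁻ x, f x * k x ∂ν) ^ r ≤ (∫⁻ x, k x ∂ν) ^ (r - 1) * ∫⁻ x, f x ^ r * k x ∂ν := by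
  have hr0 : 0 < r := by linarith
  have h := lintegral_rpow_le_weighted (μ := ν) hr (f := fun x => f x * k x) (l := k)
    (hf.mul hk).aemeasurable hk.aemeasurable
    (Filter.Eventually.of_forall fun x hx => by simp [hx])
    (Filter.Eventually.of_forall fun x => ((hk1 x).trans_lt ENNReal.one_lt_top).ne)
  refine h.trans (mul_le_mul_right (lintegral_mono fun x => ?_) _)
  by_cases hz : k x = 0
  · simp [hz, hr0]
  · rw [ENNReal.mul_rpow_of_nonneg _ _ hr0.le, mul_left_comm,
      ← ENNReal.rpow_add _ _ hz ((hk1 x).trans_lt ENNReal.one_lt_top).ne]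
    simp

/-- Hölder's inequality against a bounded integrable weight. -/
theorem lintegral_mul_le_eLpNorm {ν : Measure X} {p : ℝ≥0∞} (hp : 1 ≤ p) (hpt : p ≠ ∞)
    {f k : X → ℝ≥0∞} (hf : Measurable f) (hk : Measurable k) (hk1 : ∀ x, k x ≤ 1) :
    ∫⁻ x, f x * k x ∂ν ≤ (∫⁻ x, k x ∂ν) ^ (1 - 1 / p.toReal) * eLpNorm f p ν := by
  have hp0 : p ≠ 0 := (zero_lt_one.trans_le hp).ne'
  have hr : 1 ≤ p.toReal := by
    have := ENNReal.toReal_mono hpt hp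
    simpa using this
  have hr0 : 0 < p.toReal := by linarith
  rw [eLpNorm_eq_lintegral_rpow_enorm_toReal hp0 hpt]
  set r := p.toReal with hrdef
  simp only [enorm_eq_self]
  have h2 : (∫⁻ x, f x * k x ∂ν) ^ r ≤ (∫⁻ x, k x ∂ν) ^ (r - 1) * ∫⁻ x, f x ^ r ∂ν :=
    (lintegral_mul_rpow_le hr hf hk hk1).trans (mul_le_mul_right (lintegral_mono fun x => by
      simpa using mul_le_mul_right (hk1 x) (f x ^ r)) _)
  calc ∫⁻ x, f x * k x ∂ν = ((∫⁻ x, f x * k x ∂ν) ^ r) ^ (1 / r) := by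
        rw [← ENNReal.rpow_mul, mul_one_div_cancel hr0.ne', ENNReal.rpow_one]
    _ ≤ ((∫⁻ x, k x ∂ν) ^ (r - 1) * ∫⁻ x, f x ^ r ∂ν) ^ (1 / r) :=
        ENNReal.rpow_le_rpow h2 (by positivity)
    _ = _ := by
        rw [ENNReal.mul_rpow_of_nonneg _ _ (by positivity), ← ENNReal.rpow_mul]
        congr 2
        field_simp

end Lebesgue

/-! ### Differentiation under the integral sign to finite order -/

section ParametricIntegral

variable {α E F : Type*} [MeasurableSpace α] [NormedAddCommGroup E] [NormedSpace ℝ E]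
  [NormedAddCommGroup F] [NormedSpace ℝ F]

/-- The derivative is identified only through its values on vectors, so currying of multilinear maps
never has to be commuted with a Bochner integral of operators. -/
theorem hasFDerivAt_integral_of_apply {μ : Measure α} {f : E → α → F} {F' : E → α → E →L[ℝ] F}
    {t : E} {b : α → ℝ} {D : E →L[ℝ] F} (hm : ∀ s, AEStronglyMeasurable (f s) μ)
    (hi : Integrable (f t) μ) (hm' : AEStronglyMeasurable (F' t) μ)
    (hb : ∀ a, ∀ s ∈ Metric.ball t 1, ‖F' s a‖ ≤ b a) (hbi : Integrable b μ)
    (hF' : ∀ a s, HasFDerivAt (fun s => f s a) (F' s a) s) (hD : ∀ v, D v = ∫ a, F' t a v ∂μ) :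
    HasFDerivAt (fun s => ∫ a, f s a ∂μ) D t := by
  have key := hasFDerivAt_integral_of_dominated_of_fderiv_le (μ := μ) (𝕜 := ℝ)
    (F := f) (x₀ := t) (bound := b) (F' := F') (Metric.ball_mem_nhds t one_pos)
    (Filter.Eventually.of_forall hm) hi hm'
    (Filter.Eventually.of_forall hb) hbi (Filter.Eventually.of_forall fun a s _ => hF' a s)
  have hci : Integrable (F' t) μ := hbi.mono' hm'
    (Filter.Eventually.of_forall fun a => hb a t (Metric.mem_ball_self one_pos))
  convert key using 1
  ext v
  rw [hD, ContinuousLinearMap.integral_apply hci]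

/-- Differentiation under the integral sign for derivatives of arbitrary finite order. -/
theorem contDiff_integral_and_iteratedFDeriv {μ : Measure α} {κ : α → E → F} {N : ℕ}
    (hκ : ∀ a, ContDiff ℝ N (κ a))
    (hm : ∀ l ≤ N, ∀ t, AEStronglyMeasurable (fun a => iteratedFDeriv ℝ l (κ a) t) μ)
    (hb : ∀ l ≤ N, ∀ t₀, ∃ b : α → ℝ, Integrable b μ ∧
      ∀ a, ∀ t ∈ Metric.ball t₀ 1, ‖iteratedFDeriv ℝ l (κ a) t‖ ≤ b a) :
    ContDiff ℝ N (fun t => ∫ a, κ a t ∂μ) ∧ ∀ l ≤ N, ∀ t,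
      iteratedFDeriv ℝ l (fun t => ∫ a, κ a t ∂μ) t = ∫ a, iteratedFDeriv ℝ l (κ a) t ∂μ := by
  have hint : ∀ l ≤ N, ∀ t, Integrable (fun a => iteratedFDeriv ℝ l (κ a) t) μ := by
    intro l hl t
    obtain ⟨b, hbi, hb⟩ := hb l hl t
    exact hbi.mono' (hm l hl t) (Filter.Eventually.of_forall fun a =>
      hb a t (Metric.mem_ball_self one_pos))
  -- The termwise integrals of the derivatives form a Taylor series, and such a series determines
  -- the iterated derivatives.
  have hT : HasFTaylorSeriesUpTo N (fun t => ∫ a, κ a t ∂μ)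
      (fun t l => ∫ a, iteratedFDeriv ℝ l (κ a) t ∂μ) := by
    refine ⟨fun t => ?_, fun m hmN t => ?_, fun m hmN => ?_⟩
    · have h0 := hint 0 (Nat.zero_le _) t
      change (continuousMultilinearCurryFin0 ℝ E F) _ = _
      have := ((continuousMultilinearCurryFin0 ℝ E F).toContinuousLinearEquiv.integral_comp_comm
        (fun a => iteratedFDeriv ℝ 0 (κ a) t) (μ := μ))
      simp only [LinearIsometryEquiv.coe_toContinuousLinearEquiv] at this
      rw [← this]
      simp
    · have hmN' : m + 1 ≤ N := by exact_mod_cast hmN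
      obtain ⟨b, hbi, hb⟩ := hb (m + 1) hmN' t
      have hF' : ∀ a t, HasFDerivAt (fun t => iteratedFDeriv ℝ m (κ a) t)
          ((iteratedFDeriv ℝ (m + 1) (κ a) t).curryLeft) t := by
        intro a t
        have hd : DifferentiableAt ℝ (iteratedFDeriv ℝ m (κ a)) t :=
          ((hκ a).differentiable_iteratedFDeriv (by exact_mod_cast hmN')) t
        convert! hd.hasFDerivAt using 1
      refine hasFDerivAt_integral_of_apply (hm m (by omega)) (hint m (by omega) t)
        (F' := fun t a => (iteratedFDeriv ℝ (m + 1) (κ a) t).curryLeft)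
        ((continuousMultilinearCurryLeftEquiv ℝ (fun _ : Fin (m + 1) => E)
          F).continuous.comp_aestronglyMeasurable (hm (m + 1) hmN' t))
        (fun a s hs => by
          rw [ContinuousMultilinearMap.curryLeft_norm]; exact hb a s hs) hbi hF' ?_
      intro v
      ext w
      have hv : Integrable (fun a => (iteratedFDeriv ℝ (m + 1) (κ a) t).curryLeft v) μ := by
        refine (hbi.mul_const ‖v‖).mono' ?_ (Filter.Eventually.of_forall fun a => ?_)
        · exact ((ContinuousLinearMap.apply ℝ (E [×m]→L[ℝ] F) v).continuous.comp
            (continuousMultilinearCurryLeftEquiv ℝ (fun _ : Fin (m + 1) => E)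
              F).continuous).comp_aestronglyMeasurable (hm (m + 1) hmN' t)
        · refine (ContinuousLinearMap.le_opNorm _ v).trans ?_
          gcongr
          rw [ContinuousMultilinearMap.curryLeft_norm]
          exact hb a t (Metric.mem_ball_self one_pos)
      rw [ContinuousMultilinearMap.integral_apply hv, ContinuousMultilinearMap.curryLeft_apply,
        ContinuousMultilinearMap.integral_apply (hint (m + 1) hmN' t)]
      rfl
    · have hmN' : m ≤ N := by exact_mod_cast hmN
      refine continuous_iff_continuousAt.2 fun t => ?_
      obtain ⟨b, hbi, hb⟩ := hb m hmN' t
      refine continuousAt_of_dominated (Filter.Eventually.of_forall fun s => hm m hmN' s)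
        (bound := b) ?_ hbi ?_
      · filter_upwards [Metric.ball_mem_nhds t one_pos] with s hs
        exact Filter.Eventually.of_forall fun a => hb a s hs
      · exact Filter.Eventually.of_forall fun a =>
          ((hκ a).continuous_iteratedFDeriv (by exact_mod_cast hmN')).continuousAt
  refine ⟨hT.contDiff, fun l hl t => ?_⟩
  exact (hT.eq_iteratedFDeriv (by exact_mod_cast hl) t).symm

end ParametricIntegral

/-! ### Translations on the Schwartz space; distributions applied to integrals of Schwartz functions
-/

section Schwartz

variable {E : Type*} [NormedAddCommGroup E] [NormedSpace ℝ E]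

theorem continuous_finsetSup_seminorm (s : Finset (ℕ × ℕ)) :
    Continuous ⇑(s.sup (schwartzSeminormFamily ℂ E ℂ) : Seminorm ℂ 𝓢(E, ℂ)) := by
  refine Seminorm.continuous_of_le (p := s.sup (schwartzSeminormFamily ℂ E ℂ))
    (q := ∑ i ∈ s, schwartzSeminormFamily ℂ E ℂ i) ?_ (Seminorm.finset_sup_le_sum _ _)
  exact Seminorm.continuous_finsetSum fun i _ =>
    (schwartz_withSeminorms ℂ E ℂ).continuous_seminorm i

/-- Translations act on the Schwartz space with at most polynomial growth. -/
theorem exists_seminorm_translate_le (q : Seminorm ℂ 𝓢(E, ℂ)) (hq : Continuous q) :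
    ∃ (K : ℕ) (q' : Seminorm ℂ 𝓢(E, ℂ)), Continuous q' ∧ ∀ (x : E) (ψ : 𝓢(E, ℂ)),
      q (SchwartzMap.compSubConstCLM ℂ x ψ) ≤ (1 + ‖x‖) ^ K * q' ψ := by
  obtain ⟨s, C, -, hs⟩ := Seminorm.bound_of_continuous (schwartz_withSeminorms ℂ E ℂ) q hq
  set K := s.sup Prod.fst
  set L := s.sup Prod.snd
  set Q := (Finset.Iic (K, L)).sup (schwartzSeminormFamily ℂ E ℂ)
  refine ⟨K, (C * 2 ^ K) • Q, ?_, fun x ψ => ?_⟩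
  · exact (continuous_finsetSup_seminorm _).const_smul (C * 2 ^ K)
  · refine (hs _).trans ?_
    have h1 : (s.sup (schwartzSeminormFamily ℂ E ℂ)) (SchwartzMap.compSubConstCLM ℂ x ψ) ≤
        (1 + ‖x‖) ^ K * (2 ^ K * Q ψ) := by
      refine Seminorm.finset_sup_apply_le (by positivity) fun i hi => ?_
      rw [SchwartzMap.schwartzSeminormFamily_apply]
      refine SchwartzMap.seminorm_le_bound ℂ _ _ _ (by positivity) fun t => ?_
      have h2 : iteratedFDeriv ℝ i.2 (⇑(SchwartzMap.compSubConstCLM ℂ x ψ)) t =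
          iteratedFDeriv ℝ i.2 ψ (t - x) := iteratedFDeriv_comp_sub i.2 x t
      rw [h2]
      have h3 : ‖t‖ ≤ (1 + ‖x‖) * (1 + ‖t - x‖) := by
        have : ‖t‖ ≤ ‖t - x‖ + ‖x‖ := by simpa using norm_add_le (t - x) x
        nlinarith [norm_nonneg x, norm_nonneg (t - x)]
      have hiK : i.1 ≤ K := Finset.le_sup (f := Prod.fst) hi
      have hiL : i.2 ≤ L := Finset.le_sup (f := Prod.snd) hi
      calc ‖t‖ ^ i.1 * ‖iteratedFDeriv ℝ i.2 ψ (t - x)‖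
          ≤ ((1 + ‖x‖) * (1 + ‖t - x‖)) ^ i.1 * ‖iteratedFDeriv ℝ i.2 ψ (t - x)‖ := by gcongr
        _ = (1 + ‖x‖) ^ i.1 * ((1 + ‖t - x‖) ^ i.1 * ‖iteratedFDeriv ℝ i.2 ψ (t - x)‖) := by
            rw [mul_pow, mul_assoc]
        _ ≤ (1 + ‖x‖) ^ K * (2 ^ K * Q ψ) := by
            refine mul_le_mul (pow_le_pow_right₀ (by linarith [norm_nonneg x]) hiK) ?_
              (by positivity) (by positivity)
            exact SchwartzMap.one_add_le_sup_seminorm_apply (𝕜 := ℂ) (m := (K, L)) hiK hiL ψ _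
    calc (C • s.sup (schwartzSeminormFamily ℂ E ℂ)) (SchwartzMap.compSubConstCLM ℂ x ψ)
        = C * (s.sup (schwartzSeminormFamily ℂ E ℂ)) (SchwartzMap.compSubConstCLM ℂ x ψ) := rfl
      _ ≤ C * ((1 + ‖x‖) ^ K * (2 ^ K * Q ψ)) := by gcongr
      _ = (1 + ‖x‖) ^ K * ((C * 2 ^ K : NNReal) * Q ψ) := by push_cast; ring
      _ = _ := rfl

/-- Mean value inequality on the segment from t to t - h. As ‖h‖ ≤ 1, the weights at t and at any
point of the segment differ by at most a factor 2^k. -/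
theorem seminorm_translate_sub_le (k l : ℕ) (ψ : 𝓢(E, ℂ)) : ∃ C : ℝ, ∀ h : E, ‖h‖ ≤ 1 →
    SchwartzMap.seminorm ℂ k l (SchwartzMap.compSubConstCLM ℂ h ψ - ψ) ≤ ‖h‖ * C := by
  set Q := (Finset.Iic (k, l + 1)).sup (schwartzSeminormFamily ℂ E ℂ)
  refine ⟨2 ^ k * (2 ^ k * Q ψ), fun h hh => ?_⟩
  refine SchwartzMap.seminorm_le_bound ℂ _ _ _ (by positivity) fun t => ?_
  have hcd : ContDiff ℝ (l + 1 : ℕ) ψ := ψ.smooth (l + 1 : ℕ)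
  have h2 : iteratedFDeriv ℝ l (⇑(SchwartzMap.compSubConstCLM ℂ h ψ - ψ)) t =
      iteratedFDeriv ℝ l ψ (t - h) - iteratedFDeriv ℝ l ψ t := by
    have e1 : (⇑(SchwartzMap.compSubConstCLM ℂ h ψ - ψ)) =
        (fun z => ψ (z - h)) - ⇑ψ := rfl
    rw [e1, iteratedFDeriv_sub_apply, iteratedFDeriv_comp_sub]
    · exact ((SchwartzMap.compSubConstCLM ℂ h ψ).smooth l).contDiffAt
    · exact (ψ.smooth l).contDiffAt
  rw [h2]
  have hmv : ‖iteratedFDeriv ℝ l ψ (t - h) - iteratedFDeriv ℝ l ψ t‖ * (1 + ‖t‖) ^ k ≤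
      2 ^ k * (2 ^ k * Q ψ) * ‖(t - h) - t‖ := by
    have hb : ∀ z ∈ segment ℝ t (t - h), ‖fderiv ℝ (iteratedFDeriv ℝ l ψ) z‖ ≤
        2 ^ k * (2 ^ k * Q ψ) * ((1 + ‖t‖) ^ k)⁻¹ := by
      intro z hz
      rw [norm_fderiv_iteratedFDeriv]
      have hz1 : ‖t - z‖ ≤ ‖h‖ := by
        have := norm_sub_le_of_mem_segment hz
        rw [norm_sub_rev]; simpa using this
      have hz2 : 1 + ‖t‖ ≤ 2 * (1 + ‖z‖) := by
        have : ‖t‖ ≤ ‖t - z‖ + ‖z‖ := by simpa using norm_add_le (t - z) z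
        linarith [norm_nonneg z]
      have h4 := SchwartzMap.one_add_le_sup_seminorm_apply (𝕜 := ℂ) (m := (k, l + 1)) le_rfl
        le_rfl ψ z
      rw [← div_eq_mul_inv, le_div_iff₀ (by positivity)]
      calc ‖iteratedFDeriv ℝ (l + 1) ψ z‖ * (1 + ‖t‖) ^ k
          ≤ ‖iteratedFDeriv ℝ (l + 1) ψ z‖ * (2 * (1 + ‖z‖)) ^ k := by gcongr
        _ = 2 ^ k * ((1 + ‖z‖) ^ k * ‖iteratedFDeriv ℝ (l + 1) ψ z‖) := by rw [mul_pow]; ring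
        _ ≤ 2 ^ k * (2 ^ k * Q ψ) := mul_le_mul_of_nonneg_left h4 (by positivity)
    have := (convex_segment t (t - h)).norm_image_sub_le_of_norm_fderiv_le (𝕜 := ℝ)
      (fun z _ => (hcd.differentiable_iteratedFDeriv (by exact_mod_cast Nat.lt_succ_self l)) z)
      hb (left_mem_segment ℝ t (t - h)) (right_mem_segment ℝ t (t - h))
    calc _ ≤ 2 ^ k * (2 ^ k * Q ψ) * ((1 + ‖t‖) ^ k)⁻¹ * ‖(t - h) - t‖ * (1 + ‖t‖) ^ k := by
          gcongr
      _ = _ := by field_simp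
  have h5 : ‖(t - h) - t‖ = ‖h‖ := by simp
  rw [h5] at hmv
  calc ‖t‖ ^ k * ‖iteratedFDeriv ℝ l ψ (t - h) - iteratedFDeriv ℝ l ψ t‖
      ≤ (1 + ‖t‖) ^ k * ‖iteratedFDeriv ℝ l ψ (t - h) - iteratedFDeriv ℝ l ψ t‖ := by
        gcongr; linarith
    _ ≤ _ := by rw [mul_comm]; linarith

/-- The action of translations on the Schwartz space is jointly continuous. -/
theorem continuous_translate :
    Continuous fun z : E × 𝓢(E, ℂ) => SchwartzMap.compSubConstCLM ℂ z.1 z.2 := by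
  rw [continuous_iff_continuousAt]
  rintro ⟨x₀, ψ₀⟩
  rw [ContinuousAt, (schwartz_withSeminorms ℂ E ℂ).tendsto_nhds]
  rintro ⟨k, l⟩ ε hε
  set P := schwartzSeminormFamily ℂ E ℂ (k, l) with hP
  obtain ⟨K, q', hq', hT⟩ := exists_seminorm_translate_le P
    ((schwartz_withSeminorms ℂ E ℂ).continuous_seminorm (k, l))
  obtain ⟨C, hC⟩ := seminorm_translate_sub_le k l (SchwartzMap.compSubConstCLM ℂ x₀ ψ₀)
  have hlim : Filter.Tendsto (fun z : E × 𝓢(E, ℂ) =>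
      (1 + ‖z.1‖) ^ K * q' (z.2 - ψ₀) + ‖z.1 - x₀‖ * C) (nhds (x₀, ψ₀)) (nhds 0) := by
    have : Continuous fun z : E × 𝓢(E, ℂ) =>
        (1 + ‖z.1‖) ^ K * q' (z.2 - ψ₀) + ‖z.1 - x₀‖ * C := by fun_prop
    convert this.tendsto (x₀, ψ₀)
    simp
  have hnear : ∀ᶠ z : E × 𝓢(E, ℂ) in nhds (x₀, ψ₀), ‖z.1 - x₀‖ ≤ 1 := by
    have : Continuous fun z : E × 𝓢(E, ℂ) => ‖z.1 - x₀‖ := by fun_prop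
    exact this.continuousAt.eventually (Iic_mem_nhds (by simp))
  filter_upwards [hlim.eventually_lt_const hε, hnear] with z hz hz1
  refine lt_of_le_of_lt ?_ hz
  -- With T_x translation by x: T_x ψ - T_{x₀} ψ₀ = T_x(ψ - ψ₀) + (T_{x-x₀} - 1) T_{x₀} ψ₀.
  -- Polynomial growth controls the first term, the mean value estimate the second.
  have e1 : SchwartzMap.compSubConstCLM ℂ z.1 z.2 - SchwartzMap.compSubConstCLM ℂ x₀ ψ₀ =
      SchwartzMap.compSubConstCLM ℂ z.1 (z.2 - ψ₀) +
      (SchwartzMap.compSubConstCLM ℂ (z.1 - x₀) (SchwartzMap.compSubConstCLM ℂ x₀ ψ₀) -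
        SchwartzMap.compSubConstCLM ℂ x₀ ψ₀) := by
    rw [SchwartzMap.compSubConstCLM_comp, map_sub]
    simp
  rw [e1]
  exact (map_add_le_add P _ _).trans (add_le_add (hT _ _) (hC _ hz1))

theorem continuous_iteratedFDeriv_apply (l : ℕ) (t : E) :
    Continuous fun ψ : 𝓢(E, ℂ) => iteratedFDeriv ℝ l ψ t := by
  rw [continuous_iff_continuousAt]
  intro ψ₀
  rw [ContinuousAt, tendsto_iff_norm_sub_tendsto_zero]
  have hc : Continuous fun ψ : 𝓢(E, ℂ) => schwartzSeminormFamily ℂ E ℂ (0, l) (ψ - ψ₀) :=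
    ((schwartz_withSeminorms ℂ E ℂ).continuous_seminorm (0, l)).comp (by fun_prop)
  have h0 := hc.tendsto ψ₀
  simp only [sub_self, map_zero] at h0
  refine squeeze_zero (fun _ => norm_nonneg _) (fun ψ => ?_) h0
  have e : iteratedFDeriv ℝ l ψ t - iteratedFDeriv ℝ l ψ₀ t =
      iteratedFDeriv ℝ l (ψ - ψ₀ : 𝓢(E, ℂ)) t := by
    have e1 : (⇑(ψ - ψ₀)) = ⇑ψ - ⇑ψ₀ := rfl
    rw [e1, iteratedFDeriv_sub_apply (ψ.smooth l).contDiffAt (ψ₀.smooth l).contDiffAt]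
  rw [e]
  exact SchwartzMap.norm_iteratedFDeriv_le_seminorm ℂ _ l t

/-- Bounded continuous functions between normed spaces. -/
abbrev BddCont (X G : Type*) [NormedAddCommGroup X] [NormedAddCommGroup G] : Type _ :=
  BoundedContinuousFunction X G

/-- The `l`-th derivative of a Schwartz function with a polynomial weight, as a bounded continuous
function. -/
noncomputable def weightedDerivCLM (k l : ℕ) :
    𝓢(E, ℂ) →L[ℂ] BddCont E (E [×l]→L[ℝ] ℂ) :=
  SchwartzMap.mkCLMtoNormedSpace (𝕜 := ℂ) (σ := RingHom.id ℂ) (D := E) (E := ℂ)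
    (G := BddCont E (E [×l]→L[ℝ] ℂ))
    (fun ψ => BoundedContinuousFunction.ofNormedAddCommGroup
      (fun t => (‖t‖ ^ k) • iteratedFDeriv ℝ l ψ t)
      ((continuous_norm.pow k).smul ((ψ.smooth l).continuous_iteratedFDeriv le_rfl))
      (SchwartzMap.seminorm ℂ k l ψ) (fun t => by
        rw [norm_smul, norm_pow, norm_norm]; exact SchwartzMap.le_seminorm ℂ k l ψ t))
    (fun ψ χ => by
      refine BoundedContinuousFunction.ext fun t => ?_
      have e1 : (⇑(ψ + χ)) = ⇑ψ + ⇑χ := rfl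
      simp only [BoundedContinuousFunction.coe_ofNormedAddCommGroup,
        BoundedContinuousFunction.coe_add, Pi.add_apply]
      rw [e1, iteratedFDeriv_add_apply (ψ.smooth l).contDiffAt (χ.smooth l).contDiffAt, smul_add])
    (fun c ψ => by
      refine BoundedContinuousFunction.ext fun t => ?_
      have e1 : (⇑(c • ψ)) = c • ⇑ψ := rfl
      simp only [BoundedContinuousFunction.coe_ofNormedAddCommGroup,
        BoundedContinuousFunction.coe_smul, RingHom.id_apply]
      rw [e1, iteratedFDeriv_const_smul_apply (ψ.smooth l).contDiffAt, smul_comm])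
    ⟨{(k, l)}, 1, zero_le_one, fun ψ => by
      rw [Finset.sup_singleton, one_mul]
      exact BoundedContinuousFunction.norm_ofNormedAddCommGroup_le _
        (apply_nonneg (SchwartzMap.seminorm ℂ k l) ψ) _⟩

theorem weightedDerivCLM_apply (k l : ℕ) (ψ : 𝓢(E, ℂ)) (t : E) :
    weightedDerivCLM k l ψ t = (‖t‖ ^ k) • iteratedFDeriv ℝ l ψ t := rfl

theorem norm_weightedDerivCLM (k l : ℕ) (ψ : 𝓢(E, ℂ)) :
    ‖weightedDerivCLM k l ψ‖ = SchwartzMap.seminorm ℂ k l ψ := by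
  apply le_antisymm
  · refine (BoundedContinuousFunction.norm_le (apply_nonneg _ _)).2 fun t => ?_
    rw [weightedDerivCLM_apply, norm_smul, norm_pow, norm_norm]
    exact SchwartzMap.le_seminorm ℂ k l ψ t
  · refine SchwartzMap.seminorm_le_bound ℂ k l ψ
      (norm_nonneg (weightedDerivCLM k l ψ)) fun t => ?_
    have := (weightedDerivCLM k l ψ).norm_coe_le_norm t
    rwa [weightedDerivCLM_apply, norm_smul, norm_pow, norm_norm] at this

/-- A functional dominated by the norm of the image under a linear map into a Banach space commutes
with integrals that exist in that space. -/
theorem map_eq_integral_of_norm_le {M V Q : Type*} [AddCommGroup M] [Module ℂ M]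
    [NormedAddCommGroup V] [NormedSpace ℂ V] [CompleteSpace V] [MeasurableSpace Q] {μ : Measure Q}
    (f : M →ₗ[ℂ] ℂ) (J : M →ₗ[ℂ] V) {C : ℝ} (hJf : ∀ ψ, ‖f ψ‖ ≤ C * ‖J ψ‖) {γ : Q → M}
    (hJi : Integrable (fun q => J (γ q)) μ) {Γ : M} (hJΓ : J Γ = ∫ q, J (γ q) ∂μ) :
    f Γ = ∫ q, f (γ q) ∂μ := by
  -- The functional factors through the range of J and extends to V by Hahn–Banach; a bounded
  -- functional on V commutes with the Bochner integral.
  have hker : LinearMap.ker J ≤ LinearMap.ker f := by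
    intro ψ hψ
    have h0 : J ψ = 0 := hψ
    have := hJf ψ
    rw [h0, norm_zero, mul_zero] at this
    exact norm_le_zero_iff.1 this
  let L₀ : LinearMap.range J →ₗ[ℂ] ℂ :=
    ((LinearMap.ker J).liftQ f hker) ∘ₗ
      J.quotKerEquivRange.symm.toLinearMap
  have hL₀ : ∀ ψ, L₀ ⟨J ψ, ψ, rfl⟩ = f ψ := by
    intro ψ
    have : J.quotKerEquivRange.symm ⟨J ψ, ψ, rfl⟩ =
        (LinearMap.ker J).mkQ ψ :=
      LinearMap.quotKerEquivRange_symm_apply_image J ψ ⟨ψ, rfl⟩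
    simp only [L₀, LinearMap.comp_apply, LinearEquiv.coe_coe]
    rw [this]
    simp
  let L₁ : StrongDual ℂ (LinearMap.range J) := L₀.mkContinuous C (by
    rintro ⟨_, ψ, rfl⟩
    exact (congrArg norm (hL₀ ψ)).le.trans (hJf ψ))
  obtain ⟨g, hg, -⟩ := exists_extension_norm_eq (LinearMap.range J) L₁
  have hgJ : ∀ ψ, g (J ψ) = f ψ := fun ψ => (hg ⟨J ψ, ψ, rfl⟩).trans (hL₀ ψ)
  rw [← hgJ, hJΓ, ← ContinuousLinearMap.integral_comp_comm g hJi]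
  simp only [hgJ]

/-- Continuity on the Schwartz space is a bound by finitely many seminorms, that is, by the norm of
a finite product of Banach spaces. -/
theorem map_eq_integral_of_pi_norm_le {M Q ι : Type*} {V : ι → Type*} [Fintype ι] [AddCommGroup M]
    [Module ℂ M] [∀ i, NormedAddCommGroup (V i)] [∀ i, NormedSpace ℂ (V i)]
    [∀ i, CompleteSpace (V i)] [MeasurableSpace Q] {μ : Measure Q}
    (f : M →ₗ[ℂ] ℂ) (J : ∀ i, M →ₗ[ℂ] V i) {C : ℝ}
    (hJf : ∀ ψ r, 0 ≤ r → (∀ i, ‖J i ψ‖ ≤ r) → ‖f ψ‖ ≤ C * r) {γ : Q → M}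
    (hJi : ∀ i, Integrable (fun q => J i (γ q)) μ) {Γ : M}
    (hJΓ : ∀ i, J i Γ = ∫ q, J i (γ q) ∂μ) :
    f Γ = ∫ q, f (γ q) ∂μ := by
  have hint : Integrable (fun q => LinearMap.pi J (γ q)) μ := Integrable.of_eval hJi
  refine map_eq_integral_of_norm_le f (LinearMap.pi J) (C := C)
    (fun ψ => hJf ψ _ (norm_nonneg _) fun i => norm_le_pi_norm (LinearMap.pi J ψ) i) hint ?_
  funext i
  exact (hJΓ i).trans (eval_integral hJi i).symm

theorem boundedContinuousFunction_eq_integral {X G Q : Type*} [TopologicalSpace X]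
    [NormedAddCommGroup G] [NormedSpace ℝ G] [CompleteSpace G] [MeasurableSpace Q] {μ : Measure Q}
    {γ : Q → BoundedContinuousFunction X G} (hγ : Integrable γ μ)
    {Γ : BoundedContinuousFunction X G} (h : ∀ t, Γ t = ∫ q, γ q t ∂μ) : Γ = ∫ q, γ q ∂μ :=
  BoundedContinuousFunction.ext fun t => by
    rw [h]
    exact (BoundedContinuousFunction.evalCLM ℝ t).integral_comp_comm hγ

/-- A tempered distribution commutes with integrals of continuous families of Schwartz functions
all of whose seminorms are integrable. -/
theorem temperedDistribution_integral {Q : Type*} [MeasurableSpace Q] [TopologicalSpace Q]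
    [OpensMeasurableSpace Q] [SecondCountableTopology Q] {μ : Measure Q} (f : 𝓢'(E, ℂ))
    {γ : Q → 𝓢(E, ℂ)} (hγ : Continuous γ)
    (hint : ∀ k l, Integrable (fun q => SchwartzMap.seminorm ℂ k l (γ q)) μ) {Γ : 𝓢(E, ℂ)}
    (hΓ : ∀ t, Γ t = ∫ q, γ q t ∂μ) : f Γ = ∫ q, f (γ q) ∂μ := by
  have hderiv : ∀ l t, iteratedFDeriv ℝ l Γ t = ∫ q, iteratedFDeriv ℝ l (γ q) t ∂μ := by
    intro l t
    have e : (⇑Γ) = fun t => ∫ q, γ q t ∂μ := funext hΓ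
    rw [e]
    refine (contDiff_integral_and_iteratedFDeriv (N := l) (fun q => (γ q).smooth l)
      (fun m _ t => ?_) (fun m _ t₀ => ?_)).2 l le_rfl t
    · exact ((continuous_iteratedFDeriv_apply m t).comp hγ).aestronglyMeasurable
    · exact ⟨_, hint 0 m, fun q t _ => SchwartzMap.norm_iteratedFDeriv_le_seminorm ℂ _ m t⟩
  let q : Seminorm ℂ 𝓢(E, ℂ) := (normSeminorm ℂ ℂ).comp (f : 𝓢(E, ℂ) →ₗ[ℂ] ℂ)
  have hq : Continuous q := continuous_norm.comp f.continuous
  -- Only the seminorms in the finite set s matter, so the integral can be taken in a finite product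
  -- of spaces of bounded continuous functions rather than in the Fréchet space.
  obtain ⟨s, C, -, hs⟩ := Seminorm.bound_of_continuous (schwartz_withSeminorms ℂ E ℂ) q hq
  have hi : ∀ k l, Integrable (fun q => weightedDerivCLM k l (γ q)) μ := fun k l =>
    (hint k l).mono' ((weightedDerivCLM k l).continuous.comp hγ).aestronglyMeasurable
      (Filter.Eventually.of_forall fun q => (norm_weightedDerivCLM k l (γ q)).le)
  refine map_eq_integral_of_pi_norm_le (f : 𝓢(E, ℂ) →ₗ[ℂ] ℂ) (C := C)
    (V := fun i : s => BddCont E (E [×(i : ℕ × ℕ).2]→L[ℝ] ℂ))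
    (fun i => (weightedDerivCLM i.1.1 i.1.2).toLinearMap) (fun ψ r hr hψ => ?_)
    (fun i => hi _ _) (fun i => ?_)
  · refine (hs ψ).trans ?_
    change (C : ℝ) * _ ≤ _
    gcongr
    refine Seminorm.finset_sup_apply_le hr fun i hi => ?_
    rw [SchwartzMap.schwartzSeminormFamily_apply, ← norm_weightedDerivCLM]
    exact hψ ⟨i, hi⟩
  · refine boundedContinuousFunction_eq_integral (hi _ _) fun t => ?_
    simp only [weightedDerivCLM_apply, ContinuousLinearMap.coe_coe]
    rw [hderiv, integral_smul]

end Schwartz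

/-! ### Time-frequency atoms: continuity and growth of their seminorms -/

section Atoms

variable {n : ℕ}

/-- The complex conjugate of a Schwartz function. -/
noncomputable def conjS (φ : 𝓢(Rn n, ℂ)) : 𝓢(Rn n, ℂ) :=
  SchwartzMap.postcompCLM (𝕜 := ℝ) (Complex.conjCLE : ℂ →L[ℝ] ℂ) φ

@[simp] theorem conjS_apply (φ : 𝓢(Rn n, ℂ)) (t : Rn n) : conjS φ t = conj (φ t) := by
  simp [conjS]

/-- The time-frequency atoms, with frequencies normalised as in the Fourier transform `𝓕`. -/
noncomputable def atom (φ : 𝓢(Rn n, ℂ)) (q : Rn n × Rn n) : 𝓢(Rn n, ℂ) :=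
  conjAtom φ q.1 ((2 * Real.pi) • q.2)

/-- The character `t ↦ e^{2πi t·η}`. -/
noncomputable def character (η t : Rn n) : ℂ :=
  Complex.exp (((2 * Real.pi * inner ℝ t η : ℝ) : ℂ) * Complex.I)

theorem norm_character (η t : Rn n) : ‖character η t‖ = 1 := by
  rw [character, Complex.norm_exp_ofReal_mul_I]

theorem continuous_character : Continuous fun z : Rn n × Rn n => character z.1 z.2 := by
  unfold character; fun_prop

theorem character_neg (η t : Rn n) : character (-η) t = conj (character η t) := by
  rw [character, character, ← Complex.exp_conj, map_mul, Complex.conj_ofReal, Complex.conj_I]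
  simp [inner_neg_right]

theorem character_mul (η ω t : Rn n) : character η t * character ω t = character (η + ω) t := by
  rw [character, character, character, ← Complex.exp_add, inner_add_right]
  congr 1
  push_cast
  ring

theorem fourier_eq_integral_character (g : Rn n → ℂ) (ξ : Rn n) :
    𝓕 g ξ = ∫ t, character (-ξ) t * g t := by
  rw [Real.fourier_eq']
  simp [character, inner_neg_right]

theorem atom_apply (φ : 𝓢(Rn n, ℂ)) (q : Rn n × Rn n) (t : Rn n) :
    atom φ q t = character (-q.2) t * conj (φ (t - q.1)) := by
  rw [atom, conjAtom_apply, character]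
  congr 2
  rw [inner_smul_right, inner_neg_right]
  push_cast
  ring

theorem character_swap (η t : Rn n) : character η t = character t η := by
  rw [character, character, real_inner_comm]

theorem character_add_right (η s t : Rn n) :
    character η (s + t) = character η s * character η t := by
  rw [character_swap, ← character_mul, character_swap s, character_swap t]

/-- Modulation is translation conjugated by the Fourier transform. Joint continuity and polynomial
growth of the atoms thus reduce to the same facts for translations. -/
theorem atom_eq_fourier (φ : 𝓢(Rn n, ℂ)) (q : Rn n × Rn n) :
    atom φ q = FourierTransform.fourierCLE ℂ 𝓢(Rn n, ℂ) (SchwartzMap.compSubConstCLM ℂ q.2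
      ((FourierTransform.fourierCLE ℂ 𝓢(Rn n, ℂ)).symm
        (SchwartzMap.compSubConstCLM ℂ q.1 (conjS φ)))) := by
  ext t
  set χ := SchwartzMap.compSubConstCLM ℂ q.1 (conjS φ) with hχ
  have h1 : χ = FourierTransform.fourierCLE ℂ 𝓢(Rn n, ℂ)
    ((FourierTransform.fourierCLE ℂ 𝓢(Rn n, ℂ)).symm χ) := by simp
  set g := (FourierTransform.fourierCLE ℂ 𝓢(Rn n, ℂ)).symm χ
  have h2 : conj (φ (t - q.1)) = 𝓕 (⇑g) t := by
    have : χ t = conj (φ (t - q.1)) := by rw [hχ]; simp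
    rw [← this, h1, FourierTransform.fourierCLE_apply, SchwartzMap.fourier_coe]
  rw [atom_apply, h2, FourierTransform.fourierCLE_apply, SchwartzMap.fourier_coe,
    fourier_eq_integral_character, fourier_eq_integral_character,
    ← integral_add_right_eq_self
      (fun s => character (-t) s * SchwartzMap.compSubConstCLM ℂ q.2 g s) q.2, ← integral_const_mul]
  congr 1
  funext s
  rw [SchwartzMap.compSubConstCLM_apply, add_sub_cancel_right, character_add_right,
    character_swap (-q.2) t]
  have : character t (-q.2) = character (-t) q.2 := by simp [character]
  rw [this]
  ring

theorem continuous_atom (φ : 𝓢(Rn n, ℂ)) : Continuous (atom φ) := by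
  rw [show atom φ = _ from funext (atom_eq_fourier φ)]
  refine (FourierTransform.fourierCLE ℂ 𝓢(Rn n, ℂ)).continuous.comp
    (continuous_translate.comp (continuous_snd.prodMk
      ((FourierTransform.fourierCLE ℂ 𝓢(Rn n, ℂ)).symm.continuous.comp
        (continuous_translate.comp (continuous_fst.prodMk continuous_const)))))

theorem exists_seminorm_atom_le (φ : 𝓢(Rn n, ℂ)) (k l : ℕ) : ∃ (K : ℕ) (C : ℝ), 0 ≤ C ∧
    ∀ q : Rn n × Rn n, SchwartzMap.seminorm ℂ k l (atom φ q) ≤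
      C * ((1 + ‖q.1‖) ^ K * (1 + ‖q.2‖) ^ K) := by
  let P : Seminorm ℂ 𝓢(Rn n, ℂ) := (SchwartzMap.seminorm ℂ k l).comp
    (FourierTransform.fourierCLE ℂ 𝓢(Rn n, ℂ) : 𝓢(Rn n, ℂ) →ₗ[ℂ] 𝓢(Rn n, ℂ))
  have hP : Continuous P := ((schwartz_withSeminorms ℂ (Rn n) ℂ).continuous_seminorm (k, l)).comp
    (FourierTransform.fourierCLE ℂ 𝓢(Rn n, ℂ)).continuous
  obtain ⟨K₁, q₁, hq₁, h₁⟩ := exists_seminorm_translate_le P hP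
  let P₂ : Seminorm ℂ 𝓢(Rn n, ℂ) := q₁.comp
    ((FourierTransform.fourierCLE ℂ 𝓢(Rn n, ℂ)).symm : 𝓢(Rn n, ℂ) →ₗ[ℂ] 𝓢(Rn n, ℂ))
  have hP₂ : Continuous P₂ := hq₁.comp (FourierTransform.fourierCLE ℂ 𝓢(Rn n, ℂ)).symm.continuous
  obtain ⟨K₂, q₂, -, h₂⟩ := exists_seminorm_translate_le P₂ hP₂
  refine ⟨max K₁ K₂, q₂ (conjS φ), apply_nonneg _ _, fun q => ?_⟩
  rw [atom_eq_fourier]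
  have hx : 1 ≤ 1 + ‖q.1‖ := by linarith [norm_nonneg q.1]
  have hη : 1 ≤ 1 + ‖q.2‖ := by linarith [norm_nonneg q.2]
  calc _ ≤ (1 + ‖q.2‖) ^ K₁ * ((1 + ‖q.1‖) ^ K₂ * q₂ (conjS φ)) :=
        (h₁ q.2 _).trans (mul_le_mul_of_nonneg_left (h₂ q.1 (conjS φ)) (by positivity))
    _ ≤ (1 + ‖q.2‖) ^ (max K₁ K₂) * ((1 + ‖q.1‖) ^ (max K₁ K₂) * q₂ (conjS φ)) := by
        have a1 := pow_le_pow_right₀ hη (le_max_left K₁ K₂)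
        have a2 := pow_le_pow_right₀ hx (le_max_right K₁ K₂)
        have a3 : 0 ≤ q₂ (conjS φ) := apply_nonneg _ _
        gcongr
    _ = _ := by ring

end Atoms

/-! ### Polynomial decay weights -/

section Decay

variable {E : Type*} [NormedAddCommGroup E]

/-- The polynomially decaying weight `(1 + ‖t‖)^{-m}`. -/
noncomputable def dec (m : ℕ) (t : E) : ℝ := ((1 + ‖t‖) ^ m)⁻¹

theorem dec_pos (m : ℕ) (t : E) : 0 < dec m t := by unfold dec; positivity

theorem dec_le_one (m : ℕ) (t : E) : dec m t ≤ 1 :=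
  inv_le_one_of_one_le₀ (one_le_pow₀ (by linarith [norm_nonneg t]))

theorem dec_add (a b : ℕ) (t : E) : dec (a + b) t = dec a t * dec b t := by
  simp [dec, pow_add, mul_comm]

theorem dec_neg (m : ℕ) (t : E) : dec m (-t) = dec m t := by simp [dec]

theorem dec_sub_comm (m : ℕ) (s t : E) : dec m (s - t) = dec m (t - s) := by
  rw [← neg_sub, dec_neg]

/-- Since 1 + ‖s + t‖ ≤ (1 + ‖s‖)(1 + ‖t‖). This converts decay around two centres into decay in the
distance between the centres. -/
theorem dec_mul_dec_le (m : ℕ) (s t : E) : dec m s * dec m t ≤ dec m (s + t) := by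
  unfold dec
  rw [← mul_inv, ← mul_pow]
  gcongr
  nlinarith [norm_add_le s t, norm_nonneg s, norm_nonneg t]

theorem dec_le_of_dist_le_one (m : ℕ) {s t : E} (h : ‖s - t‖ ≤ 1) :
    dec m s ≤ 2 ^ m * dec m t := by
  unfold dec
  rw [← div_eq_mul_inv, inv_le_comm₀ (by positivity) (by positivity), inv_div,
    div_le_iff₀ (by positivity), ← mul_pow]
  gcongr
  have : ‖t‖ ≤ ‖s - t‖ + ‖s‖ := by
    rw [norm_sub_rev]; simpa using norm_add_le (t - s) s
  linarith [norm_nonneg s]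

theorem continuous_dec (m : ℕ) : Continuous (dec m : E → ℝ) := by
  unfold dec
  exact (by fun_prop : Continuous fun t : E => (1 + ‖t‖) ^ m).inv₀ fun t => by positivity

theorem integrable_dec {n m : ℕ} (h : n < m) : Integrable (dec m : Rn n → ℝ) := by
  have h1 := integrable_one_add_norm (E := Rn n) (μ := volume) (r := m) (by simpa using h)
  refine h1.congr (Filter.Eventually.of_forall fun t => ?_)
  simp only [dec]
  rw [Real.rpow_neg (by positivity), Real.rpow_natCast]

end Decay

/-! ### Derivative bounds for products and for Schwartz functions -/

section Derivatives

variable {E : Type*} [NormedAddCommGroup E] [NormedSpace ℝ E]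

theorem norm_iteratedFDeriv_mul_le_of_le {f g : E → ℂ} {N : ℕ} (hf : ContDiff ℝ N f)
    (hg : ContDiff ℝ N g) {t : E} {A B : ℝ} (hA : ∀ j ≤ N, ‖iteratedFDeriv ℝ j f t‖ ≤ A)
    (hB : ∀ j ≤ N, ‖iteratedFDeriv ℝ j g t‖ ≤ B) :
    ∀ j ≤ N, ‖iteratedFDeriv ℝ j (fun t => f t * g t) t‖ ≤ 2 ^ N * (A * B) := by
  intro j hj
  have hA0 : 0 ≤ A := (norm_nonneg _).trans (hA 0 (Nat.zero_le _))
  have hB0 : 0 ≤ B := (norm_nonneg _).trans (hB 0 (Nat.zero_le _))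
  refine (norm_iteratedFDeriv_mul_le hf hg t (by exact_mod_cast hj)).trans ?_
  calc ∑ i ∈ Finset.range (j + 1), (j.choose i : ℝ) * ‖iteratedFDeriv ℝ i f t‖ *
        ‖iteratedFDeriv ℝ (j - i) g t‖
      ≤ ∑ i ∈ Finset.range (j + 1), (j.choose i : ℝ) * (A * B) := by
        refine Finset.sum_le_sum fun i hi => ?_
        rw [Finset.mem_range] at hi
        rw [mul_assoc]
        gcongr
        · exact hA i (by omega)
        · exact hB (j - i) (by omega)
    _ = 2 ^ j * (A * B) := by
        rw [← Finset.sum_mul, ← Nat.cast_sum, Nat.sum_range_choose]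
        push_cast; rfl
    _ ≤ 2 ^ N * (A * B) := by gcongr; norm_num

theorem exists_iteratedFDeriv_le_dec (φ : 𝓢(E, ℂ)) (m N : ℕ) : ∃ C : ℝ, 0 ≤ C ∧
    ∀ j ≤ N, ∀ t, ‖iteratedFDeriv ℝ j φ t‖ ≤ C * dec m t := by
  refine ⟨2 ^ m * (Finset.Iic (m, N)).sup (fun m => SchwartzMap.seminorm ℂ m.1 m.2) φ,
    by positivity, fun j hj t => ?_⟩
  have h := SchwartzMap.one_add_le_sup_seminorm_apply (𝕜 := ℂ) (m := (m, N)) le_rfl hj φ t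
  rw [dec, ← div_eq_mul_inv, le_div_iff₀ (by positivity), mul_comm]
  exact h

end Derivatives

/-! ### Decay of Fourier transforms of localised functions -/

section FourierDecay

variable {n : ℕ}

/-- Control of N derivatives in L¹ gives decay of order N. By translation invariance the L¹ norms,
and so the constant, do not depend on the centre x. -/
theorem exists_fourier_le_dec (n m N : ℕ) (hm : n < m) : ∃ C : ℝ, 0 ≤ C ∧
    ∀ (g : Rn n → ℂ) (x : Rn n) (A : ℝ), ContDiff ℝ N g →
      (∀ j ≤ N, ∀ t, ‖iteratedFDeriv ℝ j g t‖ ≤ A * dec m (t - x)) →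
      ∀ ζ, ‖𝓕 g ζ‖ ≤ C * A * dec N ζ := by
  set I := ∫ t : Rn n, dec m t
  have hI : 0 ≤ I := integral_nonneg fun t => (dec_pos m t).le
  refine ⟨2 ^ N * (2 * (2 ^ N * ((N + 1) * I))), by positivity, fun g x A hg hA ζ => ?_⟩
  have hA0 : 0 ≤ A := by
    have := (norm_nonneg _).trans (hA 0 (Nat.zero_le _) x)
    exact nonneg_of_mul_nonneg_left this (dec_pos _ _)
  have hdi : Integrable fun t : Rn n => A * dec m (t - x) :=
    ((integrable_dec hm).comp_sub_right x).const_mul A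
  have hint : ∀ j ≤ N, Integrable (fun t => ‖iteratedFDeriv ℝ j g t‖) := fun j hj =>
    hdi.mono' (hg.continuous_iteratedFDeriv (by exact_mod_cast hj)).norm.aestronglyMeasurable
      (Filter.Eventually.of_forall fun t => by rw [norm_norm]; exact hA j hj t)
  have hle : ∀ j ≤ N, ∫ t, ‖iteratedFDeriv ℝ j g t‖ ≤ A * I := fun j hj => by
    refine (integral_mono (hint j hj) hdi (hA j hj)).trans (le_of_eq ?_)
    rw [integral_const_mul, integral_sub_right_eq_self (dec m : Rn n → ℝ)]
  have key : ∀ j ≤ N, ‖ζ‖ ^ j * ‖𝓕 g ζ‖ ≤ 2 ^ N * ((N + 1) * (A * I)) := by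
    intro j hj
    have h := Real.pow_mul_norm_iteratedFDeriv_fourier_le (K := 0) (N := N) (f := g)
      (by exact_mod_cast hg) (fun k l hk hl => by
        have hk0 : k = 0 := by simpa using hk
        have hl0 : l ≤ N := by exact_mod_cast hl
        subst hk0
        simpa using hint l hl0) (k := 0) (n := j) le_rfl (by exact_mod_cast hj) ζ
    rw [norm_iteratedFDeriv_zero] at h
    refine h.trans ?_
    have hs : ∑ p ∈ Finset.range (0 + 1) ×ˢ Finset.range (j + 1),
        ∫ v, ‖v‖ ^ p.1 * ‖iteratedFDeriv ℝ p.2 g v‖ ≤ (N + 1) * (A * I) := by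
      rw [Finset.sum_product]
      simp only [zero_add, Finset.range_one, Finset.sum_singleton, pow_zero, one_mul]
      calc ∑ l ∈ Finset.range (j + 1), ∫ v, ‖iteratedFDeriv ℝ l g v‖
          ≤ ∑ l ∈ Finset.range (j + 1), A * I :=
            Finset.sum_le_sum fun l hl => hle l (by rw [Finset.mem_range] at hl; omega)
        _ = (j + 1) * (A * I) := by simp
        _ ≤ (N + 1) * (A * I) := by gcongr
    simp only [pow_zero, CharP.cast_eq_zero, mul_zero, zero_add, one_mul]
    calc (2 : ℝ) ^ j * _ ≤ 2 ^ N * ((N + 1) * (A * I)) := by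
          gcongr
          · norm_num
      _ = _ := rfl
  have h0 := key 0 (Nat.zero_le _)
  have hN := key N le_rfl
  rw [dec, ← div_eq_mul_inv, le_div_iff₀ (by positivity)]
  -- Hence only the moments of order 0 and N of the Fourier transform are needed.
  have hp : (1 + ‖ζ‖) ^ N ≤ 2 ^ N * (1 + ‖ζ‖ ^ N) := by
    refine (add_pow_le zero_le_one (norm_nonneg ζ) N).trans ?_
    rw [one_pow]
    gcongr
    · norm_num
    · omega
  calc ‖𝓕 g ζ‖ * (1 + ‖ζ‖) ^ N ≤ ‖𝓕 g ζ‖ * (2 ^ N * (1 + ‖ζ‖ ^ N)) := by gcongr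
    _ = 2 ^ N * (‖ζ‖ ^ 0 * ‖𝓕 g ζ‖ + ‖ζ‖ ^ N * ‖𝓕 g ζ‖) := by ring
    _ ≤ 2 ^ N * (2 ^ N * ((N + 1) * (A * I)) + 2 ^ N * ((N + 1) * (A * I))) := by gcongr
    _ = _ := by ring

/-- Decay of the Fourier transform of a product of two translated Schwartz functions and a
further smooth factor. -/
theorem exists_fourier_mul_le_dec (φ₁ φ₂ : 𝓢(Rn n, ℂ)) (m N : ℕ) (hm : n < m) : ∃ C : ℝ, 0 ≤ C ∧
    ∀ (h : Rn n → ℂ) (x z : Rn n) (R : ℝ), ContDiff ℝ N h →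
      (∀ j ≤ N, ∀ t, ‖iteratedFDeriv ℝ j h t‖ * dec m (t - x) ≤ R) →
      ∀ ζ, ‖𝓕 (fun t => φ₁ (t - x) * φ₂ (t - z) * h t) ζ‖ ≤
        C * R * dec m (z - x) * dec N ζ := by
  obtain ⟨C₀, hC₀, hF⟩ := exists_fourier_le_dec n m N hm
  -- Decay of order 3m around x is spent in thirds: one compensates the weight in the bound on h,
  -- one combines with the decay of φ₂ around z into `dec m (z - x)`, one stays as the integrable
  -- localisation.
  obtain ⟨C₁, hC₁, h₁⟩ := exists_iteratedFDeriv_le_dec φ₁ (m + m + m) N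
  obtain ⟨C₂, hC₂, h₂⟩ := exists_iteratedFDeriv_le_dec φ₂ m N
  refine ⟨C₀ * (2 ^ N * (2 ^ N * (C₁ * C₂))), by positivity, fun h x z R hh hR ζ => ?_⟩
  have hR0 : 0 ≤ R := le_trans (mul_nonneg (norm_nonneg _) (dec_pos _ _).le)
    (hR 0 (Nat.zero_le _) 0)
  have s₁ : ContDiff ℝ N fun t => φ₁ (t - x) := (φ₁.smooth N).comp (contDiff_id.sub contDiff_const)
  have s₂ : ContDiff ℝ N fun t => φ₂ (t - z) := (φ₂.smooth N).comp (contDiff_id.sub contDiff_const)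
  refine (hF _ x (2 ^ N * (2 ^ N * (C₁ * C₂)) * R * dec m (z - x)) ((s₁.mul s₂).mul hh)
    (fun j hj t => ?_) ζ).trans (le_of_eq (by ring))
  have hd := dec_pos m (t - x)
  have e12 := norm_iteratedFDeriv_mul_le_of_le s₁ s₂ (t := t)
    (A := C₁ * dec (m + m + m) (t - x)) (B := C₂ * dec m (t - z))
    (fun j hj => by rw [iteratedFDeriv_comp_sub]; exact h₁ j hj _)
    (fun j hj => by rw [iteratedFDeriv_comp_sub]; exact h₂ j hj _)
  have e := norm_iteratedFDeriv_mul_le_of_le (s₁.mul s₂) hh (t := t) e12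
    (B := R / dec m (t - x)) (fun j hj => by
      rw [le_div_iff₀ hd]; exact hR j hj t) j hj
  refine e.trans ?_
  have hxz : dec m (t - x) * dec m (t - z) ≤ dec m (z - x) := by
    rw [dec_sub_comm m t z]
    refine (dec_mul_dec_le m _ _).trans (le_of_eq ?_)
    congr 1; abel
  rw [dec_add, dec_add]
  calc 2 ^ N * (2 ^ N * (C₁ * (dec m (t - x) * dec m (t - x) * dec m (t - x)) *
        (C₂ * dec m (t - z))) * (R / dec m (t - x)))
      = 2 ^ N * (2 ^ N * (C₁ * C₂)) * R * (dec m (t - x) * dec m (t - z)) * dec m (t - x) := by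
        field_simp
    _ ≤ 2 ^ N * (2 ^ N * (C₁ * C₂)) * R * dec m (z - x) * dec m (t - x) := by gcongr

end FourierDecay

/-! ### The synthesis operator: convergence, Fubini and smoothness -/

section Synthesis

variable {n : ℕ}

/-- The weight `dec` with values in `[0, ∞]`. -/
noncomputable def decE (m : ℕ) (t : Rn n) : ℝ≥0∞ := ENNReal.ofReal (dec m t)

theorem measurable_decE (m : ℕ) : Measurable (decE m : Rn n → ℝ≥0∞) :=
  (continuous_dec m).measurable.ennreal_ofReal

theorem decE_le_one (m : ℕ) (t : Rn n) : decE m t ≤ 1 :=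
  ENNReal.ofReal_le_one.2 (dec_le_one m t)

theorem lintegral_decE_lt_top {m : ℕ} (h : n < m) : ∫⁻ t : Rn n, decE m t < ∞ :=
  (integrable_dec h).lintegral_lt_top

/-- The `L^p` norms of the slices of a function on phase space at fixed frequency. -/
noncomputable def slice (p : ℝ≥0∞) (W : Rn n × Rn n → ℂ) (η : Rn n) : ℝ≥0∞ :=
  eLpNorm (fun x => W (x, η)) p volume

/-- The constant in the Hölder inequality `lintegral_enorm_mul_decE_le`. -/
noncomputable def holderConst (n : ℕ) (p : ℝ≥0∞) : ℝ≥0∞ :=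
  (∫⁻ t : Rn n, decE (n + 1) t) ^ (1 - 1 / p.toReal)

section

variable {p : ℝ≥0∞} (hp : 1 ≤ p) (hpt : p ≠ ∞)
include hp hpt

theorem one_le_toReal : 1 ≤ p.toReal := by
  have := ENNReal.toReal_mono hpt hp
  simpa using this

theorem holderConst_lt_top : holderConst n p < ∞ := by
  have h := one_le_toReal hp hpt
  refine ENNReal.rpow_lt_top_of_nonneg ?_ (lintegral_decE_lt_top (Nat.lt_succ_self n)).ne
  rw [sub_nonneg, div_le_one (by linarith)]
  exact h

theorem measurable_slice {W : Rn n × Rn n → ℂ} (hW : Measurable W) : Measurable (slice p W) := by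
  have hp0 : p ≠ 0 := (zero_lt_one.trans_le hp).ne'
  have : slice p W = fun η => (∫⁻ x, ‖W (x, η)‖ₑ ^ p.toReal) ^ (1 / p.toReal) := by
    funext η
    rw [slice, eLpNorm_eq_lintegral_rpow_enorm_toReal hp0 hpt]
  rw [this]
  exact (Measurable.lintegral_prod_left' (hW.enorm.pow_const p.toReal)).pow_const _

theorem lintegral_enorm_mul_decE_le {W : Rn n × Rn n → ℂ} (hW : Measurable W) (x η : Rn n) :
    ∫⁻ y, ‖W (y, η)‖ₑ * decE (n + 1) (y - x) ≤ holderConst n p * slice p W η := by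
  have h := lintegral_mul_le_eLpNorm (ν := (volume : Measure (Rn n))) hp hpt
    (f := fun y => ‖W (y, η)‖ₑ) (k := fun y => decE (n + 1) (y - x))
    (hW.comp measurable_prodMk_right).enorm
    ((measurable_decE _).comp (measurable_id.sub_const x)) (fun y => decE_le_one _ _)
  rw [lintegral_sub_right_eq_self (decE (n + 1)) x, eLpNorm_enorm] at h
  exact h

/-- Hölder in position at each frequency, uniformly in the centre x, then integration in frequency.
The choice M = 1 yields convergence of the synthesis integral; a translated decay weight yields
frequency convolutions. -/
theorem lintegral_phase_le {W : Rn n × Rn n → ℂ} (hW : Measurable W) {M : Rn n → ℝ≥0∞}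
    (hM : Measurable M) (x : Rn n) :
    ∫⁻ q : Rn n × Rn n, ‖W q‖ₑ * (decE (n + 1) (q.1 - x) * M q.2) ≤
      holderConst n p * ∫⁻ η, slice p W η * M η := by
  have hm : Measurable fun q : Rn n × Rn n => ‖W q‖ₑ * (decE (n + 1) (q.1 - x) * M q.2) :=
    hW.enorm.mul (((measurable_decE _).comp (measurable_fst.sub_const x)).mul
      (hM.comp measurable_snd))
  have hs : Measurable fun η => slice p W η * M η := (measurable_slice hp hpt hW).mul hM
  rw [Measure.volume_eq_prod, lintegral_prod_symm _ hm.aemeasurable, ← lintegral_const_mul _ hs]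
  refine lintegral_mono fun η => ?_
  have hmη : Measurable fun y => ‖W (y, η)‖ₑ * decE (n + 1) (y - x) :=
    (hW.comp measurable_prodMk_right).enorm.mul
      ((measurable_decE _).comp (measurable_id.sub_const x))
  simp only [← mul_assoc]
  rw [lintegral_mul_const _ hmη]
  exact mul_le_mul_left (lintegral_enorm_mul_decE_le hp hpt hW x η) _

theorem lintegral_phase_lt_top {W : Rn n × Rn n → ℂ} (hW : Measurable W)
    (hWi : ∫⁻ η, slice p W η < ∞) (x : Rn n) :
    ∫⁻ q : Rn n × Rn n, ‖W q‖ₑ * decE (n + 1) (q.1 - x) < ∞ := by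
  have := lintegral_phase_le hp hpt hW (M := fun _ => 1) measurable_const x
  simp only [mul_one] at this
  exact this.trans_lt (ENNReal.mul_lt_top (holderConst_lt_top hp hpt) hWi)

end

/-- The synthesis operator `W ↦ ∬ W(x, η) φ(t - x) e^{2πi t·η} dx dη`. -/
noncomputable def synth (φ : 𝓢(Rn n, ℂ)) (W : Rn n × Rn n → ℂ) (t : Rn n) : ℂ :=
  ∫ q : Rn n × Rn n, W q * conjS (atom φ q) t

theorem conjS_atom_apply (φ : 𝓢(Rn n, ℂ)) (q : Rn n × Rn n) (t : Rn n) :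
    conjS (atom φ q) t = φ (t - q.1) * character q.2 t := by
  rw [conjS_apply, atom_apply, map_mul, Complex.conj_conj, character_neg, Complex.conj_conj,
    mul_comm]

theorem continuous_conjS : Continuous (conjS : 𝓢(Rn n, ℂ) → 𝓢(Rn n, ℂ)) :=
  (SchwartzMap.postcompCLM (𝕜 := ℝ) (Complex.conjCLE : ℂ →L[ℝ] ℂ)).continuous

theorem exists_norm_le_decE (φ : 𝓢(Rn n, ℂ)) (m : ℕ) : ∃ C : ℝ≥0∞, C < ∞ ∧
    ∀ t, ‖φ t‖ₑ ≤ C * decE m t := by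
  obtain ⟨C, hC, h⟩ := exists_iteratedFDeriv_le_dec φ m 0
  refine ⟨ENNReal.ofReal C, ENNReal.ofReal_lt_top, fun t => ?_⟩
  rw [decE, ← ENNReal.ofReal_mul hC, ← ofReal_norm]
  refine ENNReal.ofReal_le_ofReal ?_
  simpa using h 0 le_rfl t

theorem continuous_atom_apply (φ : 𝓢(Rn n, ℂ)) :
    Continuous fun z : (Rn n × Rn n) × Rn n => conjS (atom φ z.1) z.2 := by
  simp only [conjS_atom_apply]
  refine (φ.continuous.comp (by fun_prop)).mul (continuous_character.comp
    (by fun_prop : Continuous fun z : (Rn n × Rn n) × Rn n => (z.1.2, z.2)))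

section

variable {p : ℝ≥0∞} (hp : 1 ≤ p) (hpt : p ≠ ∞)
include hp hpt

theorem exists_lintegral_synth_le (φ : 𝓢(Rn n, ℂ)) : ∃ C : ℝ≥0∞, C < ∞ ∧
    ∀ W : Rn n × Rn n → ℂ, Measurable W → ∀ t,
      ∫⁻ q, ‖W q * conjS (atom φ q) t‖ₑ ≤ C * ∫⁻ η, slice p W η := by
  obtain ⟨C, hC, h⟩ := exists_norm_le_decE φ (n + 1)
  refine ⟨C * holderConst n p, ENNReal.mul_lt_top hC (holderConst_lt_top hp hpt),
    fun W hW t => ?_⟩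
  have h1 := lintegral_phase_le hp hpt hW (M := fun _ => 1) measurable_const t
  simp only [mul_one] at h1
  calc ∫⁻ q, ‖W q * conjS (atom φ q) t‖ₑ
      ≤ ∫⁻ q, C * (‖W q‖ₑ * decE (n + 1) (q.1 - t)) := by
        refine lintegral_mono fun q => ?_
        rw [enorm_mul, mul_left_comm, conjS_atom_apply, enorm_mul]
        have : ‖character q.2 t‖ₑ = 1 := by rw [← ofReal_norm, norm_character]; simp
        rw [this, mul_one]
        refine mul_le_mul_right ((h _).trans (le_of_eq ?_)) _
        rw [decE, decE, dec_sub_comm]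
    _ ≤ C * (holderConst n p * ∫⁻ η, slice p W η) := by
        rw [lintegral_const_mul' _ _ hC.ne]
        exact mul_le_mul_right h1 _
    _ = _ := (mul_assoc _ _ _).symm

theorem exists_enorm_synth_le (φ : 𝓢(Rn n, ℂ)) : ∃ C : ℝ≥0∞, C < ∞ ∧
    ∀ W : Rn n × Rn n → ℂ, Measurable W → ∀ t,
      ‖synth φ W t‖ₑ ≤ C * ∫⁻ η, slice p W η := by
  obtain ⟨C, hC, h⟩ := exists_lintegral_synth_le (n := n) hp hpt φ
  exact ⟨C, hC, fun W hW t => (enorm_integral_le_lintegral_enorm _).trans (h W hW t)⟩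

theorem integrable_synth (φ : 𝓢(Rn n, ℂ)) {W : Rn n × Rn n → ℂ} (hW : Measurable W)
    (hWi : ∫⁻ η, slice p W η < ∞) (t : Rn n) :
    Integrable fun q => W q * conjS (atom φ q) t := by
  obtain ⟨C, hC, h⟩ := exists_lintegral_synth_le (n := n) hp hpt φ
  refine ⟨(hW.mul ((continuous_atom_apply φ).comp
    (continuous_id.prodMk continuous_const)).measurable).aestronglyMeasurable, ?_⟩
  exact (h W hW t).trans_lt (ENNReal.mul_lt_top hC hWi)

/-- Pairing a synthesised function with an integrable function. -/
theorem integral_mul_synth (φ : 𝓢(Rn n, ℂ)) {W : Rn n × Rn n → ℂ} (hW : Measurable W)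
    (hWi : ∫⁻ η, slice p W η < ∞) {k : Rn n → ℂ} (hk : Integrable k) :
    ∫ t, k t * synth φ W t = ∫ q, W q * ∫ t, k t * conjS (atom φ q) t := by
  obtain ⟨C, hC, h⟩ := exists_lintegral_synth_le (n := n) hp hpt φ
  have hm : AEStronglyMeasurable (fun z : Rn n × (Rn n × Rn n) =>
      k z.1 * (W z.2 * conjS (atom φ z.2) z.1)) (volume.prod volume) := by
    refine (hk.aestronglyMeasurable.comp_fst).mul
      (((hW.comp measurable_snd).mul ?_).aestronglyMeasurable)
    exact ((continuous_atom_apply φ).comp (continuous_snd.prodMk continuous_fst)).measurable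
  have hi : Integrable (Function.uncurry fun (t : Rn n) (q : Rn n × Rn n) =>
      k t * (W q * conjS (atom φ q) t)) (volume.prod volume) := by
    refine ⟨hm, ?_⟩
    change ∫⁻ z : Rn n × (Rn n × Rn n),
      ‖k z.1 * (W z.2 * conjS (atom φ z.2) z.1)‖ₑ ∂(volume.prod volume) < ∞
    rw [lintegral_prod _ hm.enorm]
    calc ∫⁻ t, ∫⁻ q, ‖k t * (W q * conjS (atom φ q) t)‖ₑ
        ≤ ∫⁻ t, ‖k t‖ₑ * (C * ∫⁻ η, slice p W η) := by
          refine lintegral_mono fun t => ?_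
          simp only [enorm_mul (k t)]
          rw [lintegral_const_mul' _ _ enorm_ne_top]
          exact mul_le_mul_right (h W hW t) _
      _ = (∫⁻ t, ‖k t‖ₑ) * (C * ∫⁻ η, slice p W η) :=
          lintegral_mul_const' _ _ (ENNReal.mul_lt_top hC hWi).ne
      _ < ∞ := ENNReal.mul_lt_top hk.2 (ENNReal.mul_lt_top hC hWi)
  calc ∫ t, k t * synth φ W t = ∫ t, ∫ q, k t * (W q * conjS (atom φ q) t) := by
        simp only [synth, integral_const_mul]
    _ = ∫ q, ∫ t, k t * (W q * conjS (atom φ q) t) := integral_integral_swap hi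
    _ = _ := by
        congr 1; funext q
        rw [← integral_const_mul]
        congr 1; funext t; ring

end

section Smoothness

theorem norm_iteratedFDeriv_character_le (η t : Rn n) (j : ℕ) :
    ‖iteratedFDeriv ℝ j (character η) t‖ ≤ (2 * Real.pi * ‖η‖) ^ j := by
  set g : ℝ → ℂ := fun u => Complex.exp ((2 * Real.pi * Complex.I) * (u : ℂ)) with hg
  have hgc : ContDiff ℝ j g := by
    have : ContDiff ℝ j (fun u : ℝ => (u : ℂ)) := Complex.ofRealCLM.contDiff
    fun_prop
  have hd : ∀ m : ℕ, iteratedDeriv m g = fun u : ℝ => (2 * Real.pi * Complex.I) ^ m *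
      Complex.exp ((2 * Real.pi * Complex.I) * (u : ℂ)) := by
    intro m
    induction m with
    | zero => simp [hg]
    | succ k ih =>
      rw [iteratedDeriv_succ, ih]
      funext u
      have h := (((Complex.ofRealCLM.hasDerivAt (x := u)).const_mul
        (2 * Real.pi * Complex.I)).cexp).const_mul ((2 * Real.pi * Complex.I) ^ k)
      simp only [Complex.ofRealCLM_apply, Complex.ofReal_one, mul_one] at h
      rw [h.deriv]
      ring
  have he : character η = g ∘ (innerSL ℝ η) := by
    funext s
    simp only [character, hg, Function.comp_apply, innerSL_apply_apply, real_inner_comm η]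
    congr 1; push_cast; ring
  rw [he, (innerSL ℝ η).iteratedFDeriv_comp_right hgc t le_rfl]
  refine (ContinuousMultilinearMap.norm_compContinuousLinearMap_le _ _).trans ?_
  rw [norm_iteratedFDeriv_eq_norm_iteratedDeriv, hd]
  simp only [norm_mul, norm_pow, Complex.norm_I, Complex.norm_exp, Finset.prod_const,
    Finset.card_univ, Fintype.card_fin, innerSL_apply_norm, mul_pow, Complex.norm_real]
  simp [abs_of_pos Real.pi_pos]

theorem contDiff_character (η : Rn n) (N : ℕ) : ContDiff ℝ N (character η) := by
  unfold character
  have : ContDiff ℝ N fun t : Rn n => ((2 * Real.pi * inner ℝ t η : ℝ) : ℂ) :=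
    Complex.ofRealCLM.contDiff.comp (contDiff_const.mul (contDiff_id.inner ℝ contDiff_const))
  fun_prop

theorem exists_norm_iteratedFDeriv_atom_le (φ : 𝓢(Rn n, ℂ)) (N m : ℕ) : ∃ C : ℝ, 0 ≤ C ∧
    ∀ q : Rn n × Rn n, ∀ j ≤ N, ∀ t, ‖iteratedFDeriv ℝ j (conjS (atom φ q)) t‖ ≤
      C * (1 + ‖q.2‖) ^ N * dec m (q.1 - t) := by
  obtain ⟨C, hC, h⟩ := exists_iteratedFDeriv_le_dec φ m N
  refine ⟨2 ^ N * (C * (2 * Real.pi) ^ N), by positivity, fun q j hj t => ?_⟩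
  have e : (⇑(conjS (atom φ q))) = fun t => φ (t - q.1) * character q.2 t :=
    funext (conjS_atom_apply φ q)
  have h1 : (1 : ℝ) ≤ 2 * Real.pi := by linarith [Real.pi_gt_three]
  have := norm_iteratedFDeriv_mul_le_of_le (N := N) (f := fun t => φ (t - q.1))
    (g := character q.2) ((φ.smooth N).comp (contDiff_id.sub contDiff_const))
    (contDiff_character q.2 N) (t := t)
    (A := C * dec m (t - q.1)) (B := (2 * Real.pi) ^ N * (1 + ‖q.2‖) ^ N)
    (fun j hj => by rw [iteratedFDeriv_comp_sub]; exact h j hj _)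
    (fun j hj => (norm_iteratedFDeriv_character_le q.2 t j).trans (by
      rw [← mul_pow]
      calc (2 * Real.pi * ‖q.2‖) ^ j ≤ (2 * Real.pi * (1 + ‖q.2‖)) ^ j := by
            gcongr; linarith
        _ ≤ (2 * Real.pi * (1 + ‖q.2‖)) ^ N := by
            apply pow_le_pow_right₀ _ hj
            nlinarith [norm_nonneg q.2])) j hj
  rw [e]
  refine this.trans (le_of_eq ?_)
  rw [dec_sub_comm]
  ring

variable {p : ℝ≥0∞} (hp : 1 ≤ p) (hpt : p ≠ ∞)
include hp hpt

/-- Each derivative of an atom costs a power of the frequency, so bounded frequency on the set where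
W ≠ 0 suffices. For N = 0 the condition is empty with R = 1, and the lemma gives continuity and
boundedness of all synthesised functions. -/
theorem contDiff_synth (φ : 𝓢(Rn n, ℂ)) {W : Rn n × Rn n → ℂ} (hW : Measurable W)
    (hWi : ∫⁻ η, slice p W η < ∞) (N : ℕ) {R : ℝ} (hR : ∀ q, W q ≠ 0 → (1 + ‖q.2‖) ^ N ≤ R) :
    ContDiff ℝ N (synth φ W) ∧ ∃ A : ℝ, ∀ j ≤ N, ∀ t,
      ‖iteratedFDeriv ℝ j (synth φ W) t‖ ≤ A := by
  obtain ⟨C, hC, h⟩ := exists_norm_iteratedFDeriv_atom_le φ N (n + 1)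
  have hder : ∀ l ≤ N, ∀ q t, iteratedFDeriv ℝ l (fun t => W q * conjS (atom φ q) t) t =
      W q • iteratedFDeriv ℝ l (conjS (atom φ q)) t := fun l _ q t =>
    iteratedFDeriv_const_smul_apply (a := W q) ((conjS (atom φ q)).smooth l).contDiffAt
  have hbd : ∀ l ≤ N, ∀ q t, ‖iteratedFDeriv ℝ l (fun t => W q * conjS (atom φ q) t) t‖ ≤
      C * R * (‖W q‖ * dec (n + 1) (q.1 - t)) := by
    intro l hl q t
    rw [hder l hl, norm_smul]
    by_cases hq : W q = 0
    · simp [hq]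
    · have hd := dec_pos (n + 1) (q.1 - t)
      calc ‖W q‖ * ‖iteratedFDeriv ℝ l (conjS (atom φ q)) t‖
          ≤ ‖W q‖ * (C * (1 + ‖q.2‖) ^ N * dec (n + 1) (q.1 - t)) := by
            gcongr; exact h q l hl t
        _ ≤ ‖W q‖ * (C * R * dec (n + 1) (q.1 - t)) := by gcongr; exact hR q hq
        _ = _ := by ring
  have hint : ∀ t, Integrable fun q : Rn n × Rn n => ‖W q‖ * dec (n + 1) (q.1 - t) := by
    intro t
    refine ⟨(hW.norm.mul ((continuous_dec (n + 1)).measurable.comp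
      (measurable_fst.sub_const t))).aestronglyMeasurable, ?_⟩
    refine (lintegral_mono fun q => ?_).trans_lt (lintegral_phase_lt_top hp hpt hW hWi t)
    rw [enorm_mul, enorm_norm, decE, ← ofReal_norm (dec _ _), Real.norm_of_nonneg
      (dec_pos _ _).le]
  have hRC : 0 ≤ C * R ∨ ∀ q, W q = 0 := by
    by_cases hz : ∀ q, W q = 0
    · exact Or.inr hz
    · push Not at hz
      obtain ⟨q, hq⟩ := hz
      exact Or.inl (mul_nonneg hC (le_trans (by positivity) (hR q hq)))
  obtain ⟨h1, h2⟩ := contDiff_integral_and_iteratedFDeriv (N := N) (μ := volume)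
    (κ := fun (q : Rn n × Rn n) t => W q * conjS (atom φ q) t)
    (fun q => contDiff_const.mul ((conjS (atom φ q)).smooth N))
    (fun l hl t => by
      simp only [hder l hl]
      exact hW.aestronglyMeasurable.smul ((continuous_iteratedFDeriv_apply l t).comp
        (continuous_conjS.comp (continuous_atom φ))).aestronglyMeasurable)
    (fun l hl t₀ => by
      -- The absolute value covers W = 0, where R may be negative. The factor 2^(n+1) pays for
      -- replacing t by the centre t₀ of the unit ball.
      refine ⟨fun q => |C * R| * (2 ^ (n + 1) * (‖W q‖ * dec (n + 1) (q.1 - t₀))),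
        ((hint t₀).const_mul _).const_mul _, fun q t ht => (hbd l hl q t).trans ?_⟩
      have hd := dec_pos (n + 1) (q.1 - t)
      have : dec (n + 1) (q.1 - t) ≤ 2 ^ (n + 1) * dec (n + 1) (q.1 - t₀) := by
        refine dec_le_of_dist_le_one _ ?_
        rw [Metric.mem_ball, dist_eq_norm] at ht
        rw [sub_sub_sub_cancel_left, norm_sub_rev]
        exact ht.le
      calc C * R * (‖W q‖ * dec (n + 1) (q.1 - t))
          ≤ |C * R| * (‖W q‖ * (2 ^ (n + 1) * dec (n + 1) (q.1 - t₀))) := by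
            gcongr; exact le_abs_self _
        _ = _ := by ring)
  refine ⟨h1, |C * R| * (holderConst n p * ∫⁻ η, slice p W η).toReal, fun j hj t => ?_⟩
  have h3 : iteratedFDeriv ℝ j (synth φ W) t = _ := h2 j hj t
  rw [h3]
  refine (norm_integral_le_of_norm_le (((hint t).const_mul (|C * R|)))
    (Filter.Eventually.of_forall fun q => (hbd j hj q t).trans ?_)).trans ?_
  · have hd := dec_pos (n + 1) (q.1 - t)
    gcongr; exact le_abs_self _
  · rw [integral_const_mul]
    refine mul_le_mul_of_nonneg_left ?_ (abs_nonneg _)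
    have h4 := lintegral_phase_le hp hpt hW (M := fun _ => 1) measurable_const t
    simp only [mul_one] at h4
    rw [integral_eq_lintegral_of_nonneg_ae (Filter.Eventually.of_forall fun q =>
      mul_nonneg (norm_nonneg _) (dec_pos _ _).le) (hint t).aestronglyMeasurable]
    refine ENNReal.toReal_mono (ENNReal.mul_lt_top (holderConst_lt_top hp hpt) hWi).ne
      (le_trans (lintegral_mono fun q => ?_) h4)
    rw [ENNReal.ofReal_mul (norm_nonneg _), ofReal_norm, decE]

theorem continuous_synth (φ : 𝓢(Rn n, ℂ)) {W : Rn n × Rn n → ℂ} (hW : Measurable W)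
    (hWi : ∫⁻ η, slice p W η < ∞) : Continuous (synth φ W) :=
  (contDiff_synth hp hpt φ hW hWi 0 (R := 1) (by simp)).1.continuous

end Smoothness

end Synthesis

/-! ### Vanishing at infinity, uniqueness of the continuous representative, inversion formula -/

section FourierInversion

variable {n : ℕ}

section Vanishing

theorem tendsto_dec_cocompact {m : ℕ} (hm : m ≠ 0) (y : Rn n) :
    Filter.Tendsto (fun t : Rn n => dec m (y - t)) (Filter.cocompact (Rn n)) (nhds 0) := by
  have h1 : Filter.Tendsto (fun t : Rn n => (dec m y)⁻¹ * dec m t) (Filter.cocompact (Rn n))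
      (nhds ((dec m y)⁻¹ * 0)) := by
    refine Filter.Tendsto.const_mul _ ?_
    refine Filter.Tendsto.inv_tendsto_atTop ((Filter.tendsto_pow_atTop hm).comp ?_)
    exact Filter.tendsto_atTop_add_const_left _ _ tendsto_norm_cocompact_atTop
  rw [mul_zero] at h1
  refine squeeze_zero (fun t => (dec_pos _ _).le) (fun t => ?_) h1
  have hy := dec_pos m y
  rw [inv_mul_eq_div, le_div_iff₀ hy, ← dec_neg m y]
  refine (dec_mul_dec_le m _ _).trans (le_of_eq ?_)
  rw [← dec_neg m t]
  congr 1; abel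

theorem tendsto_decE_cocompact {m : ℕ} (hm : m ≠ 0) (y : Rn n) :
    Filter.Tendsto (fun t : Rn n => decE m (y - t)) (Filter.cocompact (Rn n)) (nhds 0) := by
  have := (ENNReal.continuous_ofReal.tendsto 0).comp (tendsto_dec_cocompact hm y)
  rw [ENNReal.ofReal_zero] at this
  exact this

/-- Needed for dominated convergence along the filter of complements of compact sets. -/
theorem isCountablyGenerated_cocompact : (Filter.cocompact (Rn n)).IsCountablyGenerated := by
  rw [← Metric.cobounded_eq_cocompact, ← comap_norm_atTop]
  infer_instance

variable {p : ℝ≥0∞} (hp : 1 ≤ p) (hpt : p ≠ ∞)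
include hp hpt

/-- Synthesised functions vanish at infinity. -/
theorem tendsto_synth_cocompact (φ : 𝓢(Rn n, ℂ)) {W : Rn n × Rn n → ℂ} (hW : Measurable W)
    (hWi : ∫⁻ η, slice p W η < ∞) :
    Filter.Tendsto (synth φ W) (Filter.cocompact (Rn n)) (nhds 0) := by
  have := isCountablyGenerated_cocompact (n := n)
  have hp0 : p ≠ 0 := (zero_lt_one.trans_le hp).ne'
  have hr := one_le_toReal hp hpt
  have hr0 : 0 < p.toReal := by linarith
  obtain ⟨C, hC, hφ⟩ := exists_norm_le_decE φ (n + 1)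
  have hWy : ∀ η, Measurable fun y => ‖W (y, η)‖ₑ := fun η =>
    (hW.comp measurable_prodMk_right).enorm
  have hd : ∀ t : Rn n, Measurable fun y : Rn n => decE (n + 1) (y - t) := fun t =>
    (measurable_decE _).comp (measurable_id.sub_const t)
  -- The weighted average of |W(·, η)| around t, whose integral over η dominates the synthesised
  -- function at t.
  set D : Rn n → Rn n → ℝ≥0∞ := fun t η => ∫⁻ y, ‖W (y, η)‖ₑ * decE (n + 1) (y - t) with hD
  have hjm : ∀ t, Measurable fun q : Rn n × Rn n => ‖W q‖ₑ * decE (n + 1) (q.1 - t) := fun t =>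
    hW.enorm.mul ((measurable_decE _).comp (measurable_fst.sub_const t))
  have hDm : ∀ t, Measurable (D t) := fun t => (hjm t).lintegral_prod_left'
  have hle : ∀ t, ‖synth φ W t‖ₑ ≤ C * ∫⁻ η, D t η := by
    intro t
    refine (enorm_integral_le_lintegral_enorm _).trans ?_
    rw [hD, ← lintegral_prod_symm _ (hjm t).aemeasurable, ← lintegral_const_mul' _ _ hC.ne,
      ← Measure.volume_eq_prod]
    refine lintegral_mono fun q => ?_
    rw [enorm_mul, mul_left_comm, conjS_atom_apply, enorm_mul]
    have : ‖character q.2 t‖ₑ = 1 := by rw [← ofReal_norm, norm_character]; simp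
    rw [this, mul_one]
    refine mul_le_mul_right ((hφ _).trans (le_of_eq ?_)) _
    rw [decE, decE, dec_sub_comm]
  -- Here finiteness of p enters: |W(·, η)|^p is integrable and serves as majorant while the weight
  -- centred at t tends to zero pointwise.
  have hpt' : ∀ η, slice p W η < ∞ →
      Filter.Tendsto (fun t => D t η) (Filter.cocompact (Rn n)) (nhds 0) := by
    intro η hη
    have hfin : ∫⁻ y, ‖W (y, η)‖ₑ ^ p.toReal ≠ ∞ := by
      rw [slice, eLpNorm_eq_lintegral_rpow_enorm_toReal hp0 hpt] at hη
      intro h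
      rw [h, ENNReal.top_rpow_of_pos (by positivity)] at hη
      exact lt_irrefl _ hη
    have h1 : Filter.Tendsto (fun t : Rn n => ∫⁻ y, ‖W (y, η)‖ₑ ^ p.toReal * decE (n + 1) (y - t))
        (Filter.cocompact (Rn n)) (nhds (∫⁻ _ : Rn n, 0)) := by
      refine tendsto_lintegral_filter_of_dominated_convergence (fun y => ‖W (y, η)‖ₑ ^ p.toReal)
        (Filter.Eventually.of_forall fun t => ((hWy η).pow_const _).mul (hd t))
        (Filter.Eventually.of_forall fun t => Filter.Eventually.of_forall fun y => ?_) hfin ?_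
      · simpa using mul_le_mul_right (decE_le_one (n + 1) (y - t)) (‖W (y, η)‖ₑ ^ p.toReal)
      · have := ae_lt_top ((hWy η).pow_const p.toReal) hfin
        filter_upwards [this] with y hy
        have := ENNReal.Tendsto.const_mul (tendsto_decE_cocompact (Nat.succ_ne_zero n) y)
          (a := ‖W (y, η)‖ₑ ^ p.toReal) (Or.inr hy.ne)
        simpa using this
    rw [lintegral_zero] at h1
    have hI : (∫⁻ y : Rn n, decE (n + 1) y) ^ (p.toReal - 1) ≠ ∞ :=
      (ENNReal.rpow_lt_top_of_nonneg (by linarith)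
        (lintegral_decE_lt_top (Nat.lt_succ_self n)).ne).ne
    have h2 := ENNReal.Tendsto.const_mul h1 (a := (∫⁻ y : Rn n, decE (n + 1) y) ^ (p.toReal - 1))
      (Or.inr hI)
    have h3 : Filter.Tendsto (fun t => D t η ^ p.toReal) (Filter.cocompact (Rn n)) (nhds 0) := by
      rw [mul_zero] at h2
      refine tendsto_of_tendsto_of_tendsto_of_le_of_le tendsto_const_nhds h2
        (fun _ => zero_le) fun t => ?_
      have := lintegral_mul_rpow_le (ν := (volume : Measure (Rn n))) hr (hWy η) (hd t)
        (fun y => decE_le_one _ _)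
      rwa [lintegral_sub_right_eq_self (decE (n + 1)) t] at this
    have h4 := ((ENNReal.continuous_rpow_const (y := 1 / p.toReal)).tendsto 0).comp h3
    rw [ENNReal.zero_rpow_of_pos (by positivity)] at h4
    refine h4.congr fun t => ?_
    simp only [Function.comp_apply]
    rw [← ENNReal.rpow_mul, mul_one_div_cancel hr0.ne', ENNReal.rpow_one]
  -- A second dominated convergence, now in frequency, with the Hölder bound by the slice norms as
  -- majorant.
  have hlim : Filter.Tendsto (fun t => ∫⁻ η, D t η) (Filter.cocompact (Rn n))
      (nhds (∫⁻ _ : Rn n, 0)) := by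
    refine tendsto_lintegral_filter_of_dominated_convergence
      (fun η => holderConst n p * slice p W η) (Filter.Eventually.of_forall hDm)
      (Filter.Eventually.of_forall fun t => Filter.Eventually.of_forall fun η =>
        lintegral_enorm_mul_decE_le hp hpt hW t η) ?_ ?_
    · rw [lintegral_const_mul' _ _ (holderConst_lt_top hp hpt).ne]
      exact (ENNReal.mul_lt_top (holderConst_lt_top hp hpt) hWi).ne
    · filter_upwards [ae_lt_top (measurable_slice hp hpt hW) hWi.ne] with η hη
      exact hpt' η hη
  rw [lintegral_zero] at hlim
  have h5 := ENNReal.Tendsto.const_mul hlim (a := C) (Or.inr hC.ne)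
  rw [mul_zero] at h5
  have h6 : Filter.Tendsto (fun t => ‖synth φ W t‖ₑ) (Filter.cocompact (Rn n)) (nhds 0) :=
    tendsto_of_tendsto_of_tendsto_of_le_of_le tendsto_const_nhds h5 (fun _ => zero_le) hle
  rw [tendsto_zero_iff_norm_tendsto_zero]
  refine ((ENNReal.tendsto_toReal ENNReal.zero_ne_top).comp h6).congr fun t => ?_
  simp

end Vanishing

section Uniqueness

theorem exists_schwartz_eq_ofReal {g : Rn n → ℝ} (hg : ContDiff ℝ (⊤ : ℕ∞) g)
    (hgc : HasCompactSupport g) : ∃ ψ : 𝓢(Rn n, ℂ), ∀ t, ψ t = (g t : ℂ) := by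
  have hc : HasCompactSupport fun t => (g t : ℂ) :=
    hgc.comp_left (g := fun r : ℝ => (r : ℂ)) Complex.ofReal_zero
  have ho : ContDiff ℝ (⊤ : ℕ∞) (fun r : ℝ => (r : ℂ)) := Complex.ofRealCLM.contDiff
  have hs : ContDiff ℝ (⊤ : ℕ∞) fun t => (g t : ℂ) := ho.comp hg
  exact ⟨hc.toSchwartzMap hs, fun t => rfl⟩

theorem IsContinuousFunction.unique {f : 𝓢'(Rn n, ℂ)} {u v : Rn n → ℂ}
    (hu : IsContinuousFunction f u) (hv : IsContinuousFunction f v) : u = v := by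
  have hloc : LocallyIntegrable (fun t => u t - v t) (volume : Measure (Rn n)) :=
    (hu.1.sub hv.1).locallyIntegrable
  have hae := ae_eq_zero_of_integral_contDiff_smul_eq_zero hloc (fun g hg hgc => by
    obtain ⟨ψ, hψ⟩ := exists_schwartz_eq_ofReal hg hgc
    have h1 := (hu.2 ψ).2.symm.trans (hv.2 ψ).2
    have h2 := sub_eq_zero.2 h1
    rw [← integral_sub (hu.2 ψ).1 (hv.2 ψ).1] at h2
    rw [← h2]
    congr 1
    funext t
    rw [hψ, Complex.real_smul]
    ring)
  have hae' : u =ᵐ[volume] v := hae.mono fun t ht => sub_eq_zero.1 ht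
  exact (Continuous.ae_eq_iff_eq volume hu.1 hv.1).1 hae'

theorem integrable_mul_schwartz {u : Rn n → ℂ} (hu : Continuous u) {C : ℝ} (hC : ∀ t, ‖u t‖ ≤ C)
    (ψ : 𝓢(Rn n, ℂ)) : Integrable fun t => u t * ψ t :=
  ψ.integrable.bdd_mul hu.aestronglyMeasurable (Filter.Eventually.of_forall hC)

/-- Bounded continuous functions are tempered distributions. -/
theorem exists_isContinuousFunction {u : Rn n → ℂ} (hu : Continuous u) {C : ℝ}
    (hC : ∀ t, ‖u t‖ ≤ C) : ∃ f : 𝓢'(Rn n, ℂ), IsContinuousFunction f u := by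
  have hm : MemLp u ∞ (volume : Measure (Rn n)) :=
    memLp_top_of_bound hu.aestronglyMeasurable C (Filter.Eventually.of_forall hC)
  refine ⟨Lp.toTemperedDistribution (hm.toLp u), hu, fun ψ =>
    ⟨integrable_mul_schwartz hu hC ψ, ?_⟩⟩
  rw [Lp.toTemperedDistribution_apply]
  refine integral_congr_ae ?_
  filter_upwards [hm.coeFn_toLp] with t ht
  rw [ht, smul_eq_mul, mul_comm]

end Uniqueness

section Inversion

/-- The squared `L²` norm of the window. -/
noncomputable def windowConst (φ : 𝓢(Rn n, ℂ)) : ℂ := ∫ t, φ t * conj (φ t)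

theorem windowConst_ne_zero {φ : 𝓢(Rn n, ℂ)} (hφ : φ ≠ 0) : windowConst φ ≠ 0 := by
  intro h
  apply hφ
  have h1 : windowConst φ = ((∫ t, ‖φ t‖ ^ 2 : ℝ) : ℂ) := by
    rw [windowConst, ← integral_complex_ofReal]
    congr 1; funext t
    rw [Complex.mul_conj, Complex.normSq_eq_norm_sq]
  rw [h1, Complex.ofReal_eq_zero] at h
  have hi : Integrable fun t => ‖φ t‖ ^ 2 := by
    have := (integrable_mul_schwartz (u := φ) φ.continuous
      (fun t => SchwartzMap.norm_le_seminorm ℂ φ t) φ).norm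
    refine this.congr (Filter.Eventually.of_forall fun t => ?_)
    simp [pow_two]
  rw [integral_eq_zero_iff_of_nonneg (fun t => by positivity) hi] at h
  have h2 : (fun t => ‖φ t‖ ^ 2) = fun _ => (0 : ℝ) :=
    (Continuous.ae_eq_iff_eq volume (φ.continuous.norm.pow 2) continuous_const).1 h
  ext t
  simpa using congrFun h2 t

/-- The adjoint short-time Fourier transform of a Schwartz function decays rapidly. -/
theorem exists_integral_mul_atom_le (φ ψ : 𝓢(Rn n, ℂ)) (m : ℕ) (hm : n < m) : ∃ C : ℝ, 0 ≤ C ∧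
    ∀ q, ‖∫ t, ψ t * conjS (atom φ q) t‖ ≤ C * (dec m q.1 * dec m q.2) := by
  obtain ⟨C, hC, h⟩ := exists_fourier_mul_le_dec ψ φ m m hm
  refine ⟨C, hC, fun q => ?_⟩
  -- The pairing is the Fourier transform at -q.2 of ψ · φ(· - q.1), with trivial third factor and
  -- with ψ centred at 0.
  have h1 := h (fun _ => 1) 0 q.1 1 contDiff_const (fun j _ t => by
    rcases Nat.eq_zero_or_pos j with rfl | hj
    · simpa using dec_le_one m t
    · rw [iteratedFDeriv_const_of_ne hj.ne']; simp) (-q.2)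
  rw [fourier_eq_integral_character, neg_neg, dec_neg, sub_zero, mul_one, mul_assoc] at h1
  convert h1 using 3
  funext t
  rw [conjS_atom_apply, sub_zero]
  ring

theorem continuous_integral_mul_atom (φ ψ : 𝓢(Rn n, ℂ)) :
    Continuous fun q => ∫ s, ψ s * conjS (atom φ q) s := by
  have h1 : ∀ q, AEStronglyMeasurable (fun s => ψ s * conjS (atom φ q) s) volume := fun q =>
    (ψ.continuous.mul (conjS (atom φ q)).continuous).aestronglyMeasurable
  have h2 : ∀ q s, ‖ψ s * conjS (atom φ q) s‖ ≤ ‖ψ s‖ * SchwartzMap.seminorm ℂ 0 0 φ := by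
    intro q s
    rw [norm_mul, conjS_atom_apply, norm_mul, norm_character, mul_one]
    exact mul_le_mul_of_nonneg_left (SchwartzMap.norm_le_seminorm ℂ φ _) (norm_nonneg _)
  have h3 : ∀ s, Continuous fun q => ψ s * conjS (atom φ q) s := fun s => by
    simp only [conjS_atom_apply]
    refine continuous_const.mul ((φ.continuous.comp (by fun_prop)).mul (continuous_character.comp
      (by fun_prop : Continuous fun q : Rn n × Rn n => (q.2, s))))
  exact continuous_of_dominated h1 (fun q => Filter.Eventually.of_forall (h2 q))
    (ψ.integrable.norm.mul_const _) (Filter.Eventually.of_forall h3)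

/-- At fixed x the frequency integral is Fourier inversion for φ(· - x) ψ and gives ψ(t) |φ(t -
x)|². Integrating in x produces the window constant. -/
theorem integral_atom_inversion (φ ψ : 𝓢(Rn n, ℂ)) (t : Rn n) :
    windowConst φ * ψ t = ∫ q, (∫ s, ψ s * conjS (atom φ q) s) * atom φ q t := by
  obtain ⟨C, hC, h⟩ := exists_integral_mul_atom_le φ ψ (n + 1) (Nat.lt_succ_self n)
  have hcont := continuous_integral_mul_atom φ ψ
  have hint : Integrable (fun q : Rn n × Rn n =>
      (∫ s, ψ s * conjS (atom φ q) s) * atom φ q t) (volume.prod volume) := by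
    have hd := (integrable_dec (Nat.lt_succ_self n)).mul_prod (integrable_dec (Nat.lt_succ_self n))
    refine ((hd.const_mul C).mul_const (SchwartzMap.seminorm ℂ 0 0 φ)).mono'
      (hcont.mul ?_).aestronglyMeasurable (Filter.Eventually.of_forall fun q => ?_)
    · have := (continuous_atom_apply φ).comp (continuous_id.prodMk (continuous_const (y := t)))
      refine (Complex.continuous_conj.comp this).congr fun q => ?_
      simp
    · rw [norm_mul]
      refine mul_le_mul (h q) ?_ (norm_nonneg _) (mul_nonneg hC
        (mul_nonneg (dec_pos _ _).le (dec_pos _ _).le))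
      rw [atom_apply, norm_mul, norm_character, one_mul, RCLike.norm_conj]
      exact SchwartzMap.norm_le_seminorm ℂ φ _
  rw [Measure.volume_eq_prod, integral_prod _ hint]
  have hinner : ∀ x : Rn n, ∫ η, (∫ s, ψ s * conjS (atom φ (x, η)) s) * atom φ (x, η) t =
      ψ t * (φ (t - x) * conj (φ (t - x))) := by
    intro x
    set T := SchwartzMap.compSubConstCLM ℂ x φ
    set g : 𝓢(Rn n, ℂ) := SchwartzMap.smulLeftCLM ℂ (⇑T) ψ
    have hg : ∀ s, g s = φ (s - x) * ψ s := fun s => by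
      rw [SchwartzMap.smulLeftCLM_apply_apply T.hasTemperateGrowth]; rfl
    have h1 : ∀ η, ∫ s, ψ s * conjS (atom φ (x, η)) s = (𝓕⁻ g : 𝓢(Rn n, ℂ)) η := by
      intro η
      rw [SchwartzMap.fourierInv_coe, Real.fourierInv_eq_fourier_neg,
        fourier_eq_integral_character, neg_neg]
      congr 1; funext s
      rw [conjS_atom_apply, hg]; ring
    have h2 : (𝓕 (𝓕⁻ g : 𝓢(Rn n, ℂ)) : 𝓢(Rn n, ℂ)) t = g t := by
      rw [FourierTransform.fourier_fourierInv_eq]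
    rw [SchwartzMap.fourier_coe, fourier_eq_integral_character] at h2
    calc _ = ∫ η, (character (-t) η * (𝓕⁻ g : 𝓢(Rn n, ℂ)) η) * conj (φ (t - x)) := by
          congr 1; funext η
          rw [h1, atom_apply, character_swap (-η) t]
          have : character t (-η) = character (-t) η := by simp [character]
          rw [this]; ring
      _ = _ := by rw [integral_mul_const, h2, hg]; ring
  simp only [hinner]
  rw [integral_const_mul, mul_comm, windowConst]
  congr 1
  exact (integral_sub_left_eq_self (fun s => φ s * conj (φ s)) volume t).symm

/-- The pointwise formula expands ψ as an integral of atoms whose coefficients decay faster than the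
Schwartz seminorms of the atoms grow, so f may be applied under the integral. -/
theorem distribution_inversion (φ : 𝓢(Rn n, ℂ)) (f : 𝓢'(Rn n, ℂ)) (ψ : 𝓢(Rn n, ℂ)) :
    windowConst φ * f ψ = ∫ q, f (atom φ q) * ∫ s, ψ s * conjS (atom φ q) s := by
  have hcont := continuous_integral_mul_atom φ ψ
  have hγ : Continuous fun q => (∫ s, ψ s * conjS (atom φ q) s) • atom φ q :=
    hcont.smul (continuous_atom φ)
  have key := temperedDistribution_integral (μ := (volume : Measure (Rn n × Rn n))) f hγ
    (fun k l => ?_) (Γ := windowConst φ • ψ) (fun t => ?_)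
  · rw [map_smul, smul_eq_mul] at key
    rw [key]
    congr 1; funext q
    rw [map_smul, smul_eq_mul, mul_comm]
  · obtain ⟨K, C₁, hC₁, h₁⟩ := exists_seminorm_atom_le φ k l
    -- K orders of decay absorb the growth of the atom's seminorm; the remaining n + 1 give
    -- integrability in each variable.
    obtain ⟨C, hC, h⟩ := exists_integral_mul_atom_le φ ψ (n + 1 + K) (by omega)
    have hd := (integrable_dec (Nat.lt_succ_self n)).mul_prod (integrable_dec (Nat.lt_succ_self n))
    rw [Measure.volume_eq_prod]
    refine (hd.const_mul (C * C₁)).mono'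
      (((schwartz_withSeminorms ℂ (Rn n) ℂ).continuous_seminorm (k, l)).comp
        hγ).aestronglyMeasurable (Filter.Eventually.of_forall fun q => ?_)
    rw [Real.norm_of_nonneg (apply_nonneg _ _), map_smul_eq_mul]
    have e : ∀ y : Rn n, dec (n + 1 + K) y * (1 + ‖y‖) ^ K = dec (n + 1) y := fun y => by
      rw [dec_add, mul_assoc]
      have : dec K y * (1 + ‖y‖) ^ K = 1 := by unfold dec; field_simp
      rw [this, mul_one]
    calc _ ≤ C * (dec (n + 1 + K) q.1 * dec (n + 1 + K) q.2) *
          (C₁ * ((1 + ‖q.1‖) ^ K * (1 + ‖q.2‖) ^ K)) :=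
          mul_le_mul (h q) (h₁ q) (apply_nonneg _ _) (mul_nonneg hC
            (mul_nonneg (dec_pos _ _).le (dec_pos _ _).le))
      _ = C * C₁ * ((dec (n + 1 + K) q.1 * (1 + ‖q.1‖) ^ K) *
          (dec (n + 1 + K) q.2 * (1 + ‖q.2‖) ^ K)) := by ring
      _ = _ := by rw [e, e]
  · exact integral_atom_inversion φ ψ t

theorem measurable_distribution_atom (φ : 𝓢(Rn n, ℂ)) (f : 𝓢'(Rn n, ℂ)) :
    Measurable fun q => f (atom φ q) :=
  (f.continuous.comp (continuous_atom φ)).measurable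

variable {p : ℝ≥0∞} (hp : 1 ≤ p) (hpt : p ≠ ∞)
include hp hpt

theorem exists_norm_synth_le (φ : 𝓢(Rn n, ℂ)) {W : Rn n × Rn n → ℂ} (hW : Measurable W)
    (hWi : ∫⁻ η, slice p W η < ∞) : ∃ C : ℝ, ∀ t, ‖synth φ W t‖ ≤ C := by
  obtain ⟨-, A, hA⟩ := contDiff_synth hp hpt φ hW hWi 0 (R := 1) (by simp)
  exact ⟨A, fun t => by simpa using hA 0 le_rfl t⟩

/-- The inversion formula for the short-time Fourier transform. -/
theorem isContinuousFunction_synth {φ : 𝓢(Rn n, ℂ)} (hφ : φ ≠ 0) {f : 𝓢'(Rn n, ℂ)}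
    (hf : ∫⁻ η, slice p (fun q => f (atom φ q)) η < ∞) :
    IsContinuousFunction f
      (fun t => (windowConst φ)⁻¹ * synth φ (fun q => f (atom φ q)) t) := by
  have hm := measurable_distribution_atom φ f
  obtain ⟨C, hC⟩ := exists_norm_synth_le hp hpt φ hm hf
  have hc : Continuous fun t => (windowConst φ)⁻¹ * synth φ (fun q => f (atom φ q)) t :=
    continuous_const.mul (continuous_synth hp hpt φ hm hf)
  refine ⟨hc, fun ψ => ⟨?_, ?_⟩⟩
  · refine integrable_mul_schwartz hc
      (C := ‖(windowConst φ)⁻¹‖ * C) (fun t => ?_) ψ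
    rw [norm_mul]
    gcongr
    exact hC t
  · have h1 := distribution_inversion φ f ψ
    rw [← integral_mul_synth hp hpt φ hm hf ψ.integrable] at h1
    have h2 : f ψ = (windowConst φ)⁻¹ * (windowConst φ * f ψ) := by
      rw [inv_mul_cancel_left₀ (windowConst_ne_zero hφ)]
    rw [h2, h1, ← integral_const_mul]
    congr 1; funext t; ring

end Inversion

end FourierInversion

/-! ### Weighted mixed norms and the abstract multiplication estimate -/

section NormEstimates

variable {n : ℕ}

/-- The short-time Fourier transform of a function, in the normalisation of `atom`. -/
noncomputable def stftFun (φ : 𝓢(Rn n, ℂ)) (u : Rn n → ℂ) (q : Rn n × Rn n) : ℂ :=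
  ∫ t, u t * atom φ q t

theorem IsContinuousFunction.apply_atom {f : 𝓢'(Rn n, ℂ)} {u : Rn n → ℂ}
    (h : IsContinuousFunction f u) (φ : 𝓢(Rn n, ℂ)) :
    (fun q => f (atom φ q)) = stftFun φ u :=
  funext fun q => (h.2 (atom φ q)).2

theorem measurable_stftFun (φ : 𝓢(Rn n, ℂ)) {u : Rn n → ℂ} (hu : Continuous u) {C : ℝ}
    (hC : ∀ t, ‖u t‖ ≤ C) : Measurable (stftFun φ u) := by
  obtain ⟨f, hf⟩ := exists_isContinuousFunction hu hC
  rw [← hf.apply_atom φ]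
  exact measurable_distribution_atom φ f

/-- The distributional inversion formula holds at every point because both sides are continuous and
represent the same distribution. -/
theorem synth_stftFun {p : ℝ≥0∞} (hp : 1 ≤ p) (hpt : p ≠ ∞) {φ : 𝓢(Rn n, ℂ)} (hφ : φ ≠ 0)
    {u : Rn n → ℂ} (hu : Continuous u) {C : ℝ} (hC : ∀ t, ‖u t‖ ≤ C)
    (hW : ∫⁻ η, slice p (stftFun φ u) η < ∞) (t : Rn n) :
    u t = (windowConst φ)⁻¹ * synth φ (stftFun φ u) t := by
  obtain ⟨f, hf⟩ := exists_isContinuousFunction hu hC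
  rw [← hf.apply_atom φ] at hW ⊢
  exact congrFun (hf.unique (isContinuousFunction_synth hp hpt hφ hW)) t

section Weight

/-- The submultiplicative weight `(1 + |η|)^s`. -/
noncomputable def wt (s : ℝ) (η : Rn n) : ℝ≥0∞ := (1 + ‖η‖ₑ) ^ s

theorem measurable_wt (s : ℝ) : Measurable (wt s : Rn n → ℝ≥0∞) :=
  (measurable_enorm.const_add 1).pow_const s

variable {s : ℝ} (hs : 0 ≤ s)
include hs

theorem one_le_wt (η : Rn n) : 1 ≤ wt s η :=
  (ENNReal.one_rpow s).symm.le.trans (ENNReal.rpow_le_rpow le_self_add hs)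

theorem wt_add_le (η ω : Rn n) : wt s (η + ω) ≤ wt s η * wt s ω := by
  rw [wt, wt, wt, ← ENNReal.mul_rpow_of_nonneg _ _ hs]
  refine ENNReal.rpow_le_rpow ?_ hs
  calc 1 + ‖η + ω‖ₑ ≤ 1 + (‖η‖ₑ + ‖ω‖ₑ) := by gcongr; exact enorm_add_le _ _
    _ ≤ 1 + (‖η‖ₑ + ‖ω‖ₑ) + ‖η‖ₑ * ‖ω‖ₑ := le_self_add
    _ = _ := by ring

/-- Young's inequality for weighted L¹: the weight is submultiplicative, so it splits between ω and
ξ - ω. -/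
theorem lintegral_wt_convolution_le {A M : Rn n → ℝ≥0∞} (hA : Measurable A) (hM : Measurable M) :
    ∫⁻ ξ, wt s ξ * ∫⁻ ω, A ω * M (ξ - ω) ≤ (∫⁻ ω, wt s ω * A ω) * ∫⁻ ζ, wt s ζ * M ζ := by
  have hw := measurable_wt (n := n) s
  have hMs : ∀ ω, Measurable fun ξ : Rn n => wt s (ξ - ω) * M (ξ - ω) := fun ω =>
    (hw.mul hM).comp (measurable_id.sub_const ω)
  have hj : Measurable fun z : Rn n × Rn n => wt s z.1 * (A z.2 * M (z.1 - z.2)) :=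
    (hw.comp measurable_fst).mul ((hA.comp measurable_snd).mul
      (hM.comp (measurable_fst.sub measurable_snd)))
  have hwA : Measurable fun ω => wt s ω * A ω := hw.mul hA
  have h1 : ∀ ξ, Measurable fun ω => A ω * M (ξ - ω) := fun ξ =>
    hA.mul (hM.comp (measurable_id.const_sub ξ))
  calc ∫⁻ ξ, wt s ξ * ∫⁻ ω, A ω * M (ξ - ω)
      = ∫⁻ ξ, ∫⁻ ω, wt s ξ * (A ω * M (ξ - ω)) := by
        congr 1; funext ξ; rw [lintegral_const_mul _ (h1 ξ)]
    _ = ∫⁻ ω, ∫⁻ ξ, wt s ξ * (A ω * M (ξ - ω)) := lintegral_lintegral_swap hj.aemeasurable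
    _ ≤ ∫⁻ ω, ∫⁻ ξ, (wt s ω * A ω) * (wt s (ξ - ω) * M (ξ - ω)) := by
        refine lintegral_mono fun ω => lintegral_mono fun ξ => ?_
        have := wt_add_le hs ω (ξ - ω)
        rw [add_sub_cancel] at this
        calc wt s ξ * (A ω * M (ξ - ω)) ≤ (wt s ω * wt s (ξ - ω)) * (A ω * M (ξ - ω)) := by gcongr
          _ = _ := by ring
    _ = ∫⁻ ω, (wt s ω * A ω) * ∫⁻ ζ, wt s ζ * M ζ := by
        congr 1; funext ω
        rw [lintegral_const_mul _ (hMs ω),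
          lintegral_sub_right_eq_self (fun ξ => wt s ξ * M ξ) ω]
    _ = _ := by rw [lintegral_mul_const _ hwA]

end Weight

/-- The mixed norm `∫ (1 + |η|)^s ‖W(·, η)‖_p dη`. -/
noncomputable def mNorm (p : ℝ≥0∞) (s : ℝ) (W : Rn n × Rn n → ℂ) : ℝ≥0∞ :=
  ∫⁻ η, wt s η * slice p W η

theorem lintegral_slice_le_mNorm (p : ℝ≥0∞) {s : ℝ} (hs : 0 ≤ s) (W : Rn n × Rn n → ℂ) :
    ∫⁻ η, slice p W η ≤ mNorm p s W :=
  lintegral_mono fun η => le_mul_of_one_le_left zero_le (one_le_wt hs η)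

section Multiplier

theorem eLpNorm_mul_const_ennreal {X : Type*} [MeasurableSpace X] {ν : Measure X} {p : ℝ≥0∞}
    (hp : 1 ≤ p) (hpt : p ≠ ∞) {F : X → ℝ≥0∞} (hF : Measurable F) (c : ℝ≥0∞) :
    eLpNorm (fun x => F x * c) p ν = eLpNorm F p ν * c := by
  have hp0 : p ≠ 0 := (zero_lt_one.trans_le hp).ne'
  have hr := one_le_toReal hp hpt
  have hr0 : 0 < p.toReal := by linarith
  rw [eLpNorm_eq_lintegral_rpow_enorm_toReal hp0 hpt, eLpNorm_eq_lintegral_rpow_enorm_toReal hp0 hpt]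
  simp only [enorm_eq_self, ENNReal.mul_rpow_of_nonneg _ _ hr0.le]
  rw [lintegral_mul_const _ (hF.pow_const _), ENNReal.mul_rpow_of_nonneg _ _ (by positivity),
    ← ENNReal.rpow_mul c, mul_one_div_cancel hr0.ne', ENNReal.rpow_one]

/-- The localised Fourier transforms of `h` are dominated by `M`, with decay off the diagonal;
such an `h` acts by multiplication on modulation spaces. -/
structure IsMult (φ : 𝓢(Rn n, ℂ)) (h : Rn n → ℂ) (M : Rn n → ℝ≥0∞) : Prop where
  measurable : Measurable M
  enorm_fourier_le : ∀ x z ζ, ‖𝓕 (fun t => conjS φ (t - x) * φ (t - z) * h t) ζ‖ₑ ≤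
    decE (n + 1) (z - x) * M ζ

variable {p : ℝ≥0∞} (hp : 1 ≤ p) (hpt : p ≠ ∞)
include hp hpt

/-- Expand g by the inversion formula. The pairing of h with an atom at (x, ξ) and a conjugate atom
at (z, ω) is the Fourier transform at ξ - ω of the twice-localised h, which is what `IsMult` bounds.
Writing z = x + r.1 makes x act on the transform of g by translation alone. -/
theorem enorm_stftFun_mul_le {φ : 𝓢(Rn n, ℂ)} (hφ : φ ≠ 0) {g h : Rn n → ℂ} {M : Rn n → ℝ≥0∞}
    (hM : IsMult φ h M) (hg : Continuous g) {A B : ℝ} (hA : ∀ t, ‖g t‖ ≤ A) (hh : Continuous h)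
    (hB : ∀ t, ‖h t‖ ≤ B) (hW : ∫⁻ η, slice p (stftFun φ g) η < ∞) (x ξ : Rn n) :
    ‖stftFun φ (fun t => g t * h t) (x, ξ)‖ₑ ≤ ∫⁻ r : Rn n × Rn n,
      ‖stftFun φ g (x + r.1, r.2)‖ₑ * (‖(windowConst φ)⁻¹‖ₑ * (decE (n + 1) r.1 * M (ξ - r.2))) := by
  have hWm := measurable_stftFun φ hg hA
  set W := stftFun φ g with hWdef
  have hm1 : Measurable fun q : Rn n × Rn n => ‖W q‖ₑ *
      (‖(windowConst φ)⁻¹‖ₑ * (decE (n + 1) (q.1 - x) * M (ξ - q.2))) :=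
    hWm.enorm.mul ((((measurable_decE _).comp (measurable_fst.sub_const x)).mul
      (hM.measurable.comp (measurable_snd.const_sub ξ))).const_mul _)
  have hm2 : Measurable fun q : Rn n × Rn n => ‖W (x + q.1, q.2)‖ₑ *
      (‖(windowConst φ)⁻¹‖ₑ * (decE (n + 1) q.1 * M (ξ - q.2))) :=
    (hWm.comp ((measurable_fst.const_add x).prodMk measurable_snd)).enorm.mul
      ((((measurable_decE _).comp measurable_fst).mul
      (hM.measurable.comp (measurable_snd.const_sub ξ))).const_mul _)
  have hk : Integrable fun t => h t * atom φ (x, ξ) t := integrable_mul_schwartz hh hB _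
  have h1 : stftFun φ (fun t => g t * h t) (x, ξ) =
      (windowConst φ)⁻¹ * ∫ q, W q * ∫ t, (h t * atom φ (x, ξ) t) * conjS (atom φ q) t := by
    rw [← integral_mul_synth hp hpt φ hWm hW hk, ← integral_const_mul, stftFun]
    congr 1; funext t
    rw [synth_stftFun hp hpt hφ hg hA hW t]
    ring
  have h2 : ∀ q : Rn n × Rn n, ‖∫ t, (h t * atom φ (x, ξ) t) * conjS (atom φ q) t‖ₑ ≤
      decE (n + 1) (q.1 - x) * M (ξ - q.2) := by
    intro q
    refine le_trans (le_of_eq ?_) (hM.enorm_fourier_le x q.1 (ξ - q.2))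
    rw [fourier_eq_integral_character]
    congr 2; funext t
    rw [conjS_atom_apply, atom_apply, conjS_apply, neg_sub, sub_eq_add_neg q.2 ξ, ← character_mul]
    ring
  rw [h1, enorm_mul]
  calc _ ≤ ‖(windowConst φ)⁻¹‖ₑ * ∫⁻ q, ‖W q *
          ∫ t, (h t * atom φ (x, ξ) t) * conjS (atom φ q) t‖ₑ := by
        gcongr; exact enorm_integral_le_lintegral_enorm _
    _ = ∫⁻ q, ‖(windowConst φ)⁻¹‖ₑ * ‖W q *
          ∫ t, (h t * atom φ (x, ξ) t) * conjS (atom φ q) t‖ₑ := by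
        rw [lintegral_const_mul' _ _ enorm_ne_top]
    _ ≤ ∫⁻ q, ‖W q‖ₑ * (‖(windowConst φ)⁻¹‖ₑ * (decE (n + 1) (q.1 - x) * M (ξ - q.2))) := by
        refine lintegral_mono fun q => ?_
        rw [enorm_mul, mul_left_comm]
        gcongr
        exact h2 q
    _ = _ := by
        rw [Measure.volume_eq_prod, lintegral_prod_symm _ hm1.aemeasurable,
          lintegral_prod_symm _ hm2.aemeasurable]
        refine lintegral_congr fun ω => ?_
        rw [← lintegral_add_left_eq_self _ x]
        simp

/-- Minkowski in x and translation invariance of the L^p norm. The position kernel contributes its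
integral as a constant, and a convolution in frequency is left. -/
theorem slice_stftFun_mul_le {φ : 𝓢(Rn n, ℂ)} (hφ : φ ≠ 0) {g h : Rn n → ℂ} {M : Rn n → ℝ≥0∞}
    (hM : IsMult φ h M) (hg : Continuous g) {A B : ℝ} (hA : ∀ t, ‖g t‖ ≤ A) (hh : Continuous h)
    (hB : ∀ t, ‖h t‖ ≤ B) (hW : ∫⁻ η, slice p (stftFun φ g) η < ∞) (ξ : Rn n) :
    slice p (stftFun φ fun t => g t * h t) ξ ≤ ‖(windowConst φ)⁻¹‖ₑ * (∫⁻ t : Rn n, decE (n + 1) t) *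
      ∫⁻ ω, slice p (stftFun φ g) ω * M (ξ - ω) := by
  have hWm := measurable_stftFun φ hg hA
  set W := stftFun φ g with hWdef
  have hj : Measurable (Function.uncurry fun (x : Rn n) (r : Rn n × Rn n) => ‖W (x + r.1, r.2)‖ₑ *
      (‖(windowConst φ)⁻¹‖ₑ * (decE (n + 1) r.1 * M (ξ - r.2)))) := by
    have hM' := hM.measurable
    have hd := measurable_decE (n := n) (n + 1)
    have h1 : Measurable fun z : Rn n × (Rn n × Rn n) => (z.1 + z.2.1, z.2.2) := by fun_prop
    have h2 : Measurable fun z : Rn n × (Rn n × Rn n) => ‖W (z.1 + z.2.1, z.2.2)‖ₑ :=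
      (hWm.comp h1).enorm
    have h3 : Measurable fun z : Rn n × (Rn n × Rn n) => decE (n + 1) z.2.1 * M (ξ - z.2.2) := by
      fun_prop
    exact h2.mul (h3.const_mul _)
  have hs1 : Measurable fun ω => slice p W ω * M (ξ - ω) :=
    (measurable_slice hp hpt hWm).mul (hM.measurable.comp (measurable_id.const_sub ξ))
  have hs2 : Measurable fun r : Rn n × Rn n => slice p W r.2 *
      (‖(windowConst φ)⁻¹‖ₑ * (decE (n + 1) r.1 * M (ξ - r.2))) :=
    ((measurable_slice hp hpt hWm).comp measurable_snd).mul
      ((((measurable_decE _).comp measurable_fst).mul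
      (hM.measurable.comp (measurable_snd.const_sub ξ))).const_mul _)
  calc slice p (stftFun φ fun t => g t * h t) ξ
      ≤ eLpNorm (fun x => ∫⁻ r : Rn n × Rn n, ‖W (x + r.1, r.2)‖ₑ *
          (‖(windowConst φ)⁻¹‖ₑ * (decE (n + 1) r.1 * M (ξ - r.2)))) p volume :=
        eLpNorm_mono_enorm fun x => by
          simpa using enorm_stftFun_mul_le hp hpt hφ hM hg hA hh hB hW x ξ
    _ ≤ ∫⁻ r : Rn n × Rn n, eLpNorm (fun x => ‖W (x + r.1, r.2)‖ₑ *
          (‖(windowConst φ)⁻¹‖ₑ * (decE (n + 1) r.1 * M (ξ - r.2)))) p volume :=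
        eLpNorm_lintegral_le hp hpt hj
    _ = ∫⁻ r : Rn n × Rn n, slice p W r.2 *
          (‖(windowConst φ)⁻¹‖ₑ * (decE (n + 1) r.1 * M (ξ - r.2))) := by
        refine lintegral_congr fun r => ?_
        have h1 : Measurable fun x => W (x, r.2) := hWm.comp measurable_prodMk_right
        have h2 : Measurable fun x => ‖W (x + r.1, r.2)‖ₑ :=
          (h1.comp (measurable_id.add_const r.1)).enorm
        rw [eLpNorm_mul_const_ennreal hp hpt h2, eLpNorm_enorm, slice,
          ← eLpNorm_comp_measurePreserving h1.aestronglyMeasurable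
            (measurePreserving_add_right volume r.1)]
        rfl
    _ = _ := by
        rw [Measure.volume_eq_prod, lintegral_prod_symm _ hs2.aemeasurable, mul_comm,
          ← lintegral_mul_const _ hs1]
        refine lintegral_congr fun ω => ?_
        calc _ = ∫⁻ r : Rn n, (slice p W ω * M (ξ - ω) * ‖(windowConst φ)⁻¹‖ₑ) *
              decE (n + 1) r := by congr 1; funext r; ring
          _ = _ := by rw [lintegral_const_mul _ (measurable_decE _)]; ring

/-- The norm of the multiplication operator by `h`. -/
theorem mNorm_stftFun_mul_le {s : ℝ} (hs : 0 ≤ s) {φ : 𝓢(Rn n, ℂ)} (hφ : φ ≠ 0) {g h : Rn n → ℂ}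
    {M : Rn n → ℝ≥0∞} (hM : IsMult φ h M) (hg : Continuous g) {A B : ℝ} (hA : ∀ t, ‖g t‖ ≤ A)
    (hh : Continuous h) (hB : ∀ t, ‖h t‖ ≤ B) (hW : mNorm p s (stftFun φ g) < ∞) :
    mNorm p s (stftFun φ fun t => g t * h t) ≤
      ‖(windowConst φ)⁻¹‖ₑ * (∫⁻ t : Rn n, decE (n + 1) t) *
        (mNorm p s (stftFun φ g) * ∫⁻ ζ, wt s ζ * M ζ) := by
  have hW' := (lintegral_slice_le_mNorm p hs (stftFun φ g)).trans_lt hW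
  have hWm := measurable_stftFun φ hg hA
  have hc : ‖(windowConst φ)⁻¹‖ₑ * (∫⁻ t : Rn n, decE (n + 1) t) ≠ ∞ :=
    (ENNReal.mul_lt_top enorm_lt_top (lintegral_decE_lt_top (Nat.lt_succ_self n))).ne
  calc _ ≤ ∫⁻ ξ, (‖(windowConst φ)⁻¹‖ₑ * (∫⁻ t : Rn n, decE (n + 1) t)) * (wt s ξ *
          ∫⁻ ω, slice p (stftFun φ g) ω * M (ξ - ω)) := by
        refine lintegral_mono fun ξ => ?_
        calc _ ≤ _ := mul_le_mul_right
              (slice_stftFun_mul_le hp hpt hφ hM hg hA hh hB hW' ξ) (wt s ξ)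
          _ = _ := by ring
    _ = _ := lintegral_const_mul' _ _ hc
    _ ≤ _ := by
      gcongr
      exact lintegral_wt_convolution_le hs (measurable_slice hp hpt hWm) hM.measurable

end Multiplier

end NormEstimates

/-! ### Smooth functions and synthesised functions as multipliers -/

section Multipliers

variable {n : ℕ}

theorem lintegral_wt_mul_decE_lt_top {s : ℝ} {N : ℕ} (hN : n + ⌈s⌉₊ < N) :
    ∫⁻ ζ : Rn n, wt s ζ * decE N ζ < ∞ := by
  obtain ⟨k, rfl⟩ : ∃ k, N = k + ⌈s⌉₊ := ⟨N - ⌈s⌉₊, by omega⟩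
  refine lt_of_le_of_lt (lintegral_mono fun ζ => ?_) (lintegral_decE_lt_top (m := k) (by omega))
  have h1 : wt s ζ ≤ ENNReal.ofReal ((1 + ‖ζ‖) ^ ⌈s⌉₊) := by
    have h0 : (1 + ‖ζ‖ₑ) = ENNReal.ofReal (1 + ‖ζ‖) := by
      rw [ENNReal.ofReal_add zero_le_one (norm_nonneg _), ENNReal.ofReal_one, ofReal_norm]
    rw [ENNReal.ofReal_pow (by positivity), ← h0, ← ENNReal.rpow_natCast]
    exact ENNReal.rpow_le_rpow_of_exponent_le le_self_add (Nat.le_ceil s)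
  refine (mul_le_mul_left h1 _).trans (le_of_eq ?_)
  rw [decE, decE, ← ENNReal.ofReal_mul (by positivity), dec_add]
  congr 1
  have : (1 + ‖ζ‖) ^ ⌈s⌉₊ * dec ⌈s⌉₊ ζ = 1 := by unfold dec; field_simp
  rw [mul_left_comm, this, mul_one]

/-- N bounded derivatives give an envelope of decay N, which is integrable against the weight of
order s once N > n + ⌈s⌉. -/
theorem exists_isMult_of_contDiff (φ : 𝓢(Rn n, ℂ)) (N : ℕ) : ∃ C : ℝ≥0∞, C < ∞ ∧
    ∀ (b : Rn n → ℂ) (A : ℝ), ContDiff ℝ N b → (∀ j ≤ N, ∀ t, ‖iteratedFDeriv ℝ j b t‖ ≤ A) →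
      IsMult φ b fun ζ => C * ENNReal.ofReal A * decE N ζ := by
  obtain ⟨C, hC, h⟩ := exists_fourier_mul_le_dec (conjS φ) φ (n + 1) N (Nat.lt_succ_self n)
  refine ⟨ENNReal.ofReal C, ENNReal.ofReal_lt_top, fun b A hb hA =>
    ⟨(measurable_decE N).const_mul _, fun x z ζ => ?_⟩⟩
  have hA0 : 0 ≤ A := (norm_nonneg _).trans (hA 0 (Nat.zero_le _) 0)
  have h1 := h b x z A hb (fun j hj t =>
    (mul_le_of_le_one_right (norm_nonneg _) (dec_le_one _ _)).trans (hA j hj t)) ζ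
  rw [decE, decE, ← ENNReal.ofReal_mul hC, ← ENNReal.ofReal_mul (by positivity),
    ← ENNReal.ofReal_mul (dec_pos _ _).le, ← ofReal_norm]
  exact ENNReal.ofReal_le_ofReal (h1.trans (le_of_eq (by ring)))

variable {p : ℝ≥0∞} (hp : 1 ≤ p) (hpt : p ≠ ∞)

/-- The third window is treated as the smooth factor h: its decay around y times the weight around x
is at most `dec (n + 1) (y - x)`. -/
theorem exists_fourier_mul_translate_le (φ : 𝓢(Rn n, ℂ)) (N : ℕ) : ∃ C : ℝ≥0∞, C < ∞ ∧
    ∀ x y z ζ : Rn n, ‖𝓕 (fun t => conjS φ (t - x) * φ (t - z) * φ (t - y)) ζ‖ₑ ≤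
      C * (decE (n + 1) (y - x) * decE (n + 1) (z - x) * decE N ζ) := by
  obtain ⟨C, hC, h⟩ := exists_fourier_mul_le_dec (conjS φ) φ (n + 1) N (Nat.lt_succ_self n)
  obtain ⟨C', hC', h'⟩ := exists_iteratedFDeriv_le_dec φ (n + 1) N
  refine ⟨ENNReal.ofReal (C * C'), ENNReal.ofReal_lt_top, fun x y z ζ => ?_⟩
  have hs : ContDiff ℝ N fun t => φ (t - y) :=
    (φ.smooth N).comp (contDiff_id.sub contDiff_const)
  have h1 := h (fun t => φ (t - y)) x z (C' * dec (n + 1) (y - x)) hs (fun j hj t => by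
    rw [iteratedFDeriv_comp_sub]
    calc _ ≤ C' * dec (n + 1) (t - y) * dec (n + 1) (t - x) :=
          mul_le_mul_of_nonneg_right (h' j hj _) (dec_pos _ _).le
      _ = C' * (dec (n + 1) (y - t) * dec (n + 1) (t - x)) := by rw [dec_sub_comm, mul_assoc]
      _ ≤ C' * dec (n + 1) ((y - t) + (t - x)) := by gcongr; exact dec_mul_dec_le _ _ _
      _ = _ := by rw [sub_add_sub_cancel]) ζ
  have d1 := dec_pos (n + 1) (y - x)
  have d2 := dec_pos (n + 1) (z - x)
  rw [decE, decE, decE, ← ENNReal.ofReal_mul d1.le, ← ENNReal.ofReal_mul (by positivity),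
    ← ENNReal.ofReal_mul (by positivity), ← ofReal_norm]
  exact ENNReal.ofReal_le_ofReal (h1.trans (le_of_eq (by ring)))

include hp hpt

/-- Expanding the synthesised factor into atoms, each atom at (y, η) shifts the frequency to ζ - η
and brings decay in y - x. Hölder in y then produces the slice norms, convolved with the decay
weight. -/
theorem exists_isMult_synth (φ : 𝓢(Rn n, ℂ)) (N : ℕ) : ∃ C : ℝ≥0∞, C < ∞ ∧
    ∀ W : Rn n × Rn n → ℂ, Measurable W → ∫⁻ η, slice p W η < ∞ →
      IsMult φ (synth φ W) fun ζ => C * ∫⁻ η, slice p W η * decE N (ζ - η) := by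
  obtain ⟨C, hC, h⟩ := exists_fourier_mul_translate_le φ N
  refine ⟨C * holderConst n p, ENNReal.mul_lt_top hC (holderConst_lt_top hp hpt),
    fun W hW hWi => ⟨?_, fun x z ζ => ?_⟩⟩
  · have hsl := measurable_slice hp hpt hW
    have hd := measurable_decE (n := n) N
    have : Measurable fun r : Rn n × Rn n => slice p W r.2 * decE N (r.1 - r.2) := by fun_prop
    exact (this.lintegral_prod_right').const_mul _
  have hz : Continuous fun t => φ (t - z) := φ.continuous.comp (continuous_id.sub continuous_const)
  have hk : Integrable fun t => φ (t - z) * atom φ (x, ζ) t :=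
    integrable_mul_schwartz hz (fun t => SchwartzMap.norm_le_seminorm ℂ φ _) _
  have h1 : 𝓕 (fun t => conjS φ (t - x) * φ (t - z) * synth φ W t) ζ =
      ∫ q, W q * ∫ t, (φ (t - z) * atom φ (x, ζ) t) * conjS (atom φ q) t := by
    rw [← integral_mul_synth hp hpt φ hW hWi hk, fourier_eq_integral_character]
    congr 1; funext t
    rw [atom_apply, conjS_apply]; ring
  have h2 : ∀ q : Rn n × Rn n, ‖∫ t, (φ (t - z) * atom φ (x, ζ) t) * conjS (atom φ q) t‖ₑ ≤
      C * (decE (n + 1) (q.1 - x) * decE (n + 1) (z - x) * decE N (ζ - q.2)) := by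
    intro q
    refine le_trans (le_of_eq ?_) (h x q.1 z (ζ - q.2))
    rw [fourier_eq_integral_character]
    congr 2; funext t
    rw [conjS_atom_apply, atom_apply, conjS_apply, neg_sub, sub_eq_add_neg q.2 ζ, ← character_mul]
    ring
  have hm : Measurable fun q : Rn n × Rn n => ‖W q‖ₑ * (decE (n + 1) (q.1 - x) *
      decE N (ζ - q.2)) :=
    hW.enorm.mul (((measurable_decE _).comp (measurable_fst.sub_const x)).mul
      ((measurable_decE N).comp (measurable_snd.const_sub ζ)))
  calc _ ≤ ∫⁻ q, ‖W q * ∫ t, (φ (t - z) * atom φ (x, ζ) t) * conjS (atom φ q) t‖ₑ := by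
        rw [h1]; exact enorm_integral_le_lintegral_enorm _
    _ ≤ ∫⁻ q, C * decE (n + 1) (z - x) * (‖W q‖ₑ * (decE (n + 1) (q.1 - x) *
          decE N (ζ - q.2))) := by
        refine lintegral_mono fun q => ?_
        rw [enorm_mul]
        exact (mul_le_mul_right (h2 q) _).trans (le_of_eq (by ring))
    _ = C * decE (n + 1) (z - x) * ∫⁻ q : Rn n × Rn n, ‖W q‖ₑ * (decE (n + 1) (q.1 - x) *
          decE N (ζ - q.2)) := lintegral_const_mul _ hm
    _ ≤ C * decE (n + 1) (z - x) * (holderConst n p * ∫⁻ η, slice p W η * decE N (ζ - η)) := by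
        gcongr
        exact lintegral_phase_le hp hpt hW (M := fun η => decE N (ζ - η))
          ((measurable_decE N).comp (measurable_id.const_sub ζ)) x
    _ = _ := by ring

variable {s : ℝ} (hs : 0 ≤ s) {φ : 𝓢(Rn n, ℂ)} (hφ : φ ≠ 0)
include hs hφ

/-- Smooth functions with bounded derivatives are multipliers. -/
theorem exists_mNorm_mul_contDiff_le {N : ℕ} (hN : n + ⌈s⌉₊ < N) : ∃ C : ℝ≥0∞, C < ∞ ∧
    ∀ (b : Rn n → ℂ) (A : ℝ), ContDiff ℝ N b → (∀ j ≤ N, ∀ t, ‖iteratedFDeriv ℝ j b t‖ ≤ A) →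
      ∀ (g : Rn n → ℂ) (B : ℝ), Continuous g → (∀ t, ‖g t‖ ≤ B) →
        mNorm p s (stftFun φ g) < ∞ →
        mNorm p s (stftFun φ fun t => g t * b t) ≤
          C * ENNReal.ofReal A * mNorm p s (stftFun φ g) := by
  obtain ⟨C, hC, h⟩ := exists_isMult_of_contDiff φ N
  set D := ‖(windowConst φ)⁻¹‖ₑ * (∫⁻ t : Rn n, decE (n + 1) t) with hD
  have hDt : D < ∞ := ENNReal.mul_lt_top enorm_lt_top (lintegral_decE_lt_top (Nat.lt_succ_self n))
  set J := ∫⁻ ζ : Rn n, wt s ζ * decE N ζ with hJ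
  have hJt : J < ∞ := lintegral_wt_mul_decE_lt_top hN
  refine ⟨D * J * C, ENNReal.mul_lt_top (ENNReal.mul_lt_top hDt hJt) hC,
    fun b A hb hA g B hg hB hW => ?_⟩
  have h1 := mNorm_stftFun_mul_le hp hpt hs hφ (h b A hb hA) hg hB hb.continuous
    (fun t => by simpa using hA 0 (Nat.zero_le _) t) hW
  refine h1.trans (le_of_eq ?_)
  have hm : Measurable fun ζ : Rn n => wt s ζ * decE N ζ := (measurable_wt s).mul (measurable_decE N)
  have h2 : ∫⁻ ζ : Rn n, wt s ζ * (C * ENNReal.ofReal A * decE N ζ) =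
      C * ENNReal.ofReal A * J := by
    rw [hJ, ← lintegral_const_mul _ hm]
    congr 1; funext ζ; ring
  rw [h2, ← hD]
  ring

/-- Synthesised functions are multipliers. -/
theorem exists_mNorm_mul_synth_le : ∃ C : ℝ≥0∞, C < ∞ ∧
    ∀ W : Rn n × Rn n → ℂ, Measurable W → mNorm p s W < ∞ →
      ∀ (g : Rn n → ℂ) (B : ℝ), Continuous g → (∀ t, ‖g t‖ ≤ B) →
        mNorm p s (stftFun φ g) < ∞ →
        mNorm p s (stftFun φ fun t => g t * synth φ W t) ≤
          C * mNorm p s W * mNorm p s (stftFun φ g) := by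
  set N := n + ⌈s⌉₊ + 1
  obtain ⟨C, hC, h⟩ := exists_isMult_synth hp hpt φ N
  set D := ‖(windowConst φ)⁻¹‖ₑ * (∫⁻ t : Rn n, decE (n + 1) t) with hD
  have hDt : D < ∞ := ENNReal.mul_lt_top enorm_lt_top (lintegral_decE_lt_top (Nat.lt_succ_self n))
  set J := ∫⁻ ζ : Rn n, wt s ζ * decE N ζ with hJ
  have hJt : J < ∞ := lintegral_wt_mul_decE_lt_top (Nat.lt_succ_self _)
  refine ⟨D * J * C, ENNReal.mul_lt_top (ENNReal.mul_lt_top hDt hJt) hC,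
    fun W hW hWi g B hg hB hgi => ?_⟩
  have hWi' := (lintegral_slice_le_mNorm p hs W).trans_lt hWi
  obtain ⟨B', hB'⟩ := exists_norm_synth_le hp hpt φ hW hWi'
  have h1 := mNorm_stftFun_mul_le hp hpt hs hφ (h W hW hWi') hg hB
    (continuous_synth hp hpt φ hW hWi') hB' hgi
  refine h1.trans ?_
  have h2 : ∫⁻ ζ : Rn n, wt s ζ * (C * ∫⁻ η, slice p W η * decE N (ζ - η)) ≤
      C * (mNorm p s W * J) := by
    refine le_trans (le_of_eq ?_) (mul_le_mul_right (lintegral_wt_convolution_le hs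
      (measurable_slice hp hpt hW) (measurable_decE N)) C)
    rw [← lintegral_const_mul' _ _ hC.ne]
    congr 1; funext ζ; ring
  rw [← hD]
  calc _ ≤ D * (mNorm p s (stftFun φ g) * (C * (mNorm p s W * J))) := by gcongr
    _ = _ := by ring

end Multipliers

/-! ### Cauchy estimates for Taylor coefficients composed with a smooth function -/

section TaylorCoefficients

variable {n : ℕ}

section Taylor

variable {G : ℂ → ℂ} {O : Set ℂ} {ρ M : ℝ}

theorem iteratedDeriv_iteratedDeriv_add (G : ℂ → ℂ) (i k : ℕ) :
    iteratedDeriv i (iteratedDeriv k G) = iteratedDeriv (i + k) G := by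
  rw [iteratedDeriv_eq_iterate, iteratedDeriv_eq_iterate, iteratedDeriv_eq_iterate,
    Function.iterate_add_apply]

theorem contDiffOn_taylorCoeff (hO : IsOpen O) (hG : DifferentiableOn ℂ G O) (k N : ℕ) :
    ContDiffOn ℂ N (fun z => (k.factorial : ℂ)⁻¹ * iteratedDeriv k G z) O := by
  intro z hz
  have h1 : AnalyticAt ℂ (iteratedDeriv k G) z := by
    rw [iteratedDeriv_eq_iterate]
    exact (hG.analyticAt (hO.mem_nhds hz)).iterated_deriv k
  exact (analyticAt_const.mul h1).contDiffAt.contDiffWithinAt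

/-- Cauchy estimates for the derivatives of the Taylor coefficients. -/
theorem norm_iteratedFDeriv_taylorCoeff_le (hO : IsOpen O) (hG : DifferentiableOn ℂ G O)
    (hρ : 0 < ρ) {z : ℂ} (hz : Metric.closedBall z ρ ⊆ O)
    (hM : ∀ w ∈ Metric.closedBall z ρ, ‖G w‖ ≤ M) (k i : ℕ) :
    ‖iteratedFDeriv ℝ i (fun z => (k.factorial : ℂ)⁻¹ * iteratedDeriv k G z) z‖ ≤
      i.factorial * M * (2 / ρ) ^ i * (2 / ρ) ^ k := by
  have hzO : z ∈ O := hz (Metric.mem_closedBall_self hρ.le)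
  have hc := ((contDiffOn_taylorCoeff hO hG k i) z hzO).contDiffAt (hO.mem_nhds hzO)
  rw [← hc.restrictScalars_iteratedFDeriv (𝕜 := ℝ), Function.comp_apply,
    ContinuousMultilinearMap.norm_restrictScalars, norm_iteratedFDeriv_eq_norm_iteratedDeriv,
    iteratedDeriv_const_mul_field, iteratedDeriv_iteratedDeriv_add, norm_mul, norm_inv,
    Complex.norm_natCast]
  have hM0 : 0 ≤ M := (norm_nonneg _).trans (hM z (Metric.mem_closedBall_self hρ.le))
  have h1 := Complex.norm_iteratedDeriv_le_of_forall_mem_sphere_norm_le (i + k) hρ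
    (hG.diffContOnCl_ball hz) (fun w hw => hM w (Metric.sphere_subset_closedBall hw))
  -- The binomial bound cancels the normalisation 1/k! in exchange for 2/ρ in place of 1/ρ.
  have h2 : ((i + k).factorial : ℝ) ≤ 2 ^ (i + k) * i.factorial * k.factorial := by
    have := Nat.add_choose_mul_factorial_mul_factorial i k
    have h3 := Nat.choose_le_two_pow (i + k) k
    have h4 : (i + k).factorial ≤ 2 ^ (i + k) * i.factorial * k.factorial := by
      rw [← this]; gcongr
    exact_mod_cast h4
  have hk : (0 : ℝ) < k.factorial := by positivity
  rw [inv_mul_le_iff₀ hk]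
  refine h1.trans ?_
  calc ((i + k).factorial : ℝ) * M / ρ ^ (i + k)
      ≤ (2 ^ (i + k) * i.factorial * k.factorial) * M / ρ ^ (i + k) := by gcongr
    _ = _ := by rw [pow_add, pow_add, div_pow, div_pow]; field_simp

/-- The chain rule for higher derivatives, with B independent of k: differentiating costs constants
depending on N, M, ρ and A, and k enters only through the Cauchy bound. -/
theorem exists_taylorCoeff_comp_le (hO : IsOpen O) (hG : DifferentiableOn ℂ G O) (hρ : 0 < ρ)
    {b : Rn n → ℂ} (hb : ∀ t, Metric.closedBall (b t) ρ ⊆ O)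
    (hM : ∀ t, ∀ w ∈ Metric.closedBall (b t) ρ, ‖G w‖ ≤ M) {N : ℕ} (hbN : ContDiff ℝ N b) {A : ℝ}
    (hA : ∀ j ≤ N, ∀ t, ‖iteratedFDeriv ℝ j b t‖ ≤ A) : ∃ B : ℝ, ∀ k : ℕ,
      ContDiff ℝ N (fun t => (k.factorial : ℂ)⁻¹ * iteratedDeriv k G (b t)) ∧
      ∀ j ≤ N, ∀ t, ‖iteratedFDeriv ℝ j
        (fun t => (k.factorial : ℂ)⁻¹ * iteratedDeriv k G (b t)) t‖ ≤ B * (2 / ρ) ^ k := by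
  have hrange : Set.range b ⊆ O := by
    rintro _ ⟨t, rfl⟩
    exact hb t (Metric.mem_closedBall_self hρ.le)
  have hM0 : 0 ≤ M := (norm_nonneg _).trans (hM 0 _ (Metric.mem_closedBall_self hρ.le))
  have hA0 : 0 ≤ A := (norm_nonneg _).trans (hA 0 (Nat.zero_le _) 0)
  set C := N.factorial * M * (1 + 2 / ρ) ^ N with hC
  refine ⟨N.factorial * C * (1 + A) ^ N, fun k => ?_⟩
  have hg : ContDiffOn ℝ N (fun z => (k.factorial : ℂ)⁻¹ * iteratedDeriv k G z) O :=
    (contDiffOn_taylorCoeff hO hG k N).restrict_scalars ℝ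
  refine ⟨hg.comp_contDiff hbN fun t => hrange ⟨t, rfl⟩, fun j hj t => ?_⟩
  have hle1 : (1 : ℝ) ≤ 1 + 2 / ρ := le_add_of_nonneg_right (by positivity)
  -- The composition bound asks that the i-th derivative of b be at most D^i; D = 1 + A works
  -- because D ≥ 1.
  have h1 := norm_iteratedFDeriv_comp_le' (n := j) (N := N) (f := b) hrange hO.uniqueDiffOn hg hbN
    (by exact_mod_cast hj) t (C := C * (2 / ρ) ^ k) (D := 1 + A) (fun i hi => ?_) (fun i hi hij => ?_)
  · refine h1.trans ?_
    have : (j.factorial : ℝ) ≤ N.factorial := by exact_mod_cast Nat.factorial_le hj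
    calc _ ≤ N.factorial * (C * (2 / ρ) ^ k) * (1 + A) ^ N := by
          gcongr
          · linarith
      _ = _ := by ring
  · rw [iteratedFDerivWithin_of_isOpen i hO (hrange ⟨t, rfl⟩)]
    refine (norm_iteratedFDeriv_taylorCoeff_le hO hG hρ (hb t) (hM t) k i).trans ?_
    have : (i.factorial : ℝ) ≤ N.factorial := by exact_mod_cast Nat.factorial_le (hi.trans hj)
    have h2 : (2 / ρ) ^ i ≤ (1 + 2 / ρ) ^ N :=
      (pow_le_pow_left₀ (by positivity) (by linarith) i).trans
        (pow_le_pow_right₀ hle1 (hi.trans hj))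
    rw [hC]
    gcongr
  · refine (hA i (hij.trans hj) t).trans ?_
    calc A ≤ 1 + A := by linarith
      _ = (1 + A) ^ 1 := (pow_one _).symm
      _ ≤ _ := pow_le_pow_right₀ (by linarith) hi

end Taylor

end TaylorCoefficients

/-! ### Series of multipliers and composition with an analytic function -/

section Composition

variable {n : ℕ}

theorem stftFun_tsum (φ : 𝓢(Rn n, ℂ)) {h : ℕ → Rn n → ℂ} (hc : ∀ k, Continuous (h k)) {B : ℕ → ℝ}
    (hB : ∀ k t, ‖h k t‖ ≤ B k) (hs : Summable B) (q : Rn n × Rn n) :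
    stftFun φ (fun t => ∑' k, h k t) q = ∑' k, stftFun φ (h k) q := by
  have hi : ∀ k, Integrable fun t => h k t * atom φ q t := fun k =>
    integrable_mul_schwartz (hc k) (hB k) _
  have hsum : Summable fun k => ∫ t, ‖h k t * atom φ q t‖ := by
    refine Summable.of_nonneg_of_le (fun k => integral_nonneg fun t => norm_nonneg _) (fun k => ?_)
      (hs.mul_right (∫ t, ‖atom φ q t‖))
    rw [← integral_const_mul]
    refine integral_mono (hi k).norm ((atom φ q).integrable.norm.const_mul _) fun t => ?_
    simp only [norm_mul]
    exact mul_le_mul_of_nonneg_right (hB k t) (norm_nonneg _)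
  have h1 := (hasSum_integral_of_summable_integral_norm hi hsum).tsum_eq
  simp only [stftFun]
  rw [h1]
  congr 1; funext t
  rw [tsum_mul_right]

theorem slice_const_mul (p : ℝ≥0∞) (c : ℂ) (W : Rn n × Rn n → ℂ) (η : Rn n) :
    slice p (fun q => c * W q) η = ‖c‖ₑ * slice p W η :=
  eLpNorm_const_smul c (fun x => W (x, η)) p volume

theorem mNorm_const_mul (p : ℝ≥0∞) (s : ℝ) (c : ℂ) (W : Rn n × Rn n → ℂ) :
    mNorm p s (fun q => c * W q) = ‖c‖ₑ * mNorm p s W := by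
  rw [mNorm, mNorm, ← lintegral_const_mul' _ _ enorm_ne_top]
  congr 1; funext η
  rw [slice_const_mul, mul_left_comm]

theorem slice_ite (p : ℝ≥0∞) (P : Rn n → Prop) [DecidablePred P] (W : Rn n × Rn n → ℂ) (η : Rn n) :
    slice p (fun q => if P q.2 then W q else 0) η = if P η then slice p W η else 0 := by
  unfold slice
  split_ifs with h
  · simp [h]
  · simp [h]

theorem mNorm_ite_le (p : ℝ≥0∞) (s : ℝ) (P : Rn n → Prop) [DecidablePred P]
    (W : Rn n × Rn n → ℂ) : mNorm p s (fun q => if P q.2 then W q else 0) ≤ mNorm p s W := by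
  refine lintegral_mono fun η => ?_
  rw [slice_ite]
  gcongr
  split_ifs
  · exact le_rfl
  · exact zero_le

/-- Each further factor v costs C ‖V‖ ≤ a. The factor u is kept throughout, so that the case k = 0
is u itself and not the constant 1. The bound on the supremum only keeps the intermediate products
bounded. -/
theorem mNorm_mul_synth_pow_le {p : ℝ≥0∞} {s : ℝ} {φ : 𝓢(Rn n, ℂ)} {C : ℝ≥0∞}
    (h : ∀ W : Rn n × Rn n → ℂ, Measurable W → mNorm p s W < ∞ →
      ∀ (g : Rn n → ℂ) (B : ℝ), Continuous g → (∀ t, ‖g t‖ ≤ B) →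
        mNorm p s (stftFun φ g) < ∞ →
        mNorm p s (stftFun φ fun t => g t * synth φ W t) ≤
          C * mNorm p s W * mNorm p s (stftFun φ g))
    {V : Rn n × Rn n → ℂ} (hV : Measurable V) (hVi : mNorm p s V < ∞) {a : ℝ}
    (hCV : C * mNorm p s V ≤ ENNReal.ofReal a) (hvc : Continuous (synth φ V))
    (hva : ∀ t, ‖synth φ V t‖ ≤ a) {u : Rn n → ℂ} (hu : Continuous u) {B : ℝ}
    (hB : ∀ t, ‖u t‖ ≤ B) (hW : mNorm p s (stftFun φ u) < ∞) (k : ℕ) :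
    mNorm p s (stftFun φ fun t => u t * synth φ V t ^ k) ≤
      ENNReal.ofReal a ^ k * mNorm p s (stftFun φ u) := by
  induction k with
  | zero => simp
  | succ k ih =>
    have hc : Continuous fun t => u t * synth φ V t ^ k := hu.mul (hvc.pow k)
    have hbd : ∀ t, ‖u t * synth φ V t ^ k‖ ≤ B * a ^ k := fun t => by
      rw [norm_mul, norm_pow]
      exact mul_le_mul (hB t) (pow_le_pow_left₀ (norm_nonneg _) (hva t) k)
        (pow_nonneg (norm_nonneg _) k)
        ((norm_nonneg _).trans (hB t))
    have hfin : mNorm p s (stftFun φ fun t => u t * synth φ V t ^ k) < ∞ :=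
      ih.trans_lt (ENNReal.mul_lt_top (ENNReal.pow_lt_top ENNReal.ofReal_lt_top) hW)
    have h1 := h V hV hVi _ _ hc hbd hfin
    have e : (fun t => u t * synth φ V t ^ (k + 1)) =
        fun t => u t * synth φ V t ^ k * synth φ V t := by
      funext t; ring
    rw [e]
    calc _ ≤ _ := h1
      _ ≤ ENNReal.ofReal a * (ENNReal.ofReal a ^ k * mNorm p s (stftFun φ u)) := by gcongr
      _ = _ := by ring

variable {p : ℝ≥0∞} (hp : 1 ≤ p) (hpt : p ≠ ∞)
include hp hpt

/-- The countable triangle inequality, as Minkowski's inequality for counting measure; completeness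
of the modulation space plays no role. -/
theorem mNorm_le_tsum {s : ℝ} {V : Rn n × Rn n → ℂ} {W : ℕ → Rn n × Rn n → ℂ}
    (hW : ∀ k, Measurable (W k)) (hV : ∀ q, ‖V q‖ₑ ≤ ∑' k, ‖W k q‖ₑ) :
    mNorm p s V ≤ ∑' k, mNorm p s (W k) := by
  have h1 : ∀ η, slice p V η ≤ ∑' k, slice p (W k) η := by
    intro η
    have hm : Measurable (Function.uncurry fun (x : Rn n) (k : ℕ) => ‖W k (x, η)‖ₑ) :=
      measurable_from_prod_countable_left fun k => ((hW k).comp measurable_prodMk_right).enorm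
    calc slice p V η ≤ eLpNorm (fun x => ∫⁻ k, ‖W k (x, η)‖ₑ ∂Measure.count) p volume := by
          refine eLpNorm_mono_enorm fun x => ?_
          rw [lintegral_count]
          exact hV (x, η)
      _ ≤ ∫⁻ k, eLpNorm (fun x => ‖W k (x, η)‖ₑ) p volume ∂Measure.count :=
          eLpNorm_lintegral_le hp hpt hm
      _ = _ := by
          rw [lintegral_count]
          simp only [eLpNorm_enorm, slice]
  calc mNorm p s V ≤ ∫⁻ η, ∑' k, wt s η * slice p (W k) η := by
        refine lintegral_mono fun η => ?_
        rw [ENNReal.tsum_mul_left]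
        gcongr
        exact h1 η
    _ = _ := lintegral_tsum fun k =>
        ((measurable_wt s).mul (measurable_slice hp hpt (hW k))).aemeasurable

/-- The norm is a convergent integral over frequency, so its tails tend to zero. -/
theorem exists_mNorm_high_frequency_le {s : ℝ} {W : Rn n × Rn n → ℂ} (hW : Measurable W)
    (hWi : mNorm p s W < ∞) {ε : ℝ≥0∞} (hε : ε ≠ 0) :
    ∃ R : ℕ, mNorm p s (fun q => if (R : ℝ) < ‖q.2‖ then W q else 0) ≤ ε := by
  have hm : Measurable fun η => wt s η * slice p W η :=
    (measurable_wt s).mul (measurable_slice hp hpt hW)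
  have h1 : Filter.Tendsto (fun R : ℕ => ∫⁻ η : Rn n, if (R : ℝ) < ‖η‖ then
      wt s η * slice p W η else 0) Filter.atTop (nhds (∫⁻ _ : Rn n, 0)) := by
    refine tendsto_lintegral_of_dominated_convergence (fun η => wt s η * slice p W η)
      (fun R => Measurable.ite (measurableSet_lt measurable_const measurable_norm) hm
        measurable_const) (fun R => Filter.Eventually.of_forall fun η => ?_) hWi.ne
      (Filter.Eventually.of_forall fun η => ?_)
    · dsimp only
      split_ifs
      · exact le_rfl
      · exact zero_le
    · refine tendsto_const_nhds.congr' ?_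
      filter_upwards [Filter.eventually_ge_atTop ⌈‖η‖⌉₊] with R hR
      rw [if_neg (not_lt.2 ((Nat.le_ceil _).trans (by exact_mod_cast hR)))]
  rw [lintegral_zero] at h1
  obtain ⟨R, hR⟩ := (h1.eventually (Iic_mem_nhds (pos_iff_ne_zero.2 hε))).exists
  refine ⟨R, le_trans (le_of_eq ?_) hR⟩
  refine lintegral_congr fun η => ?_
  rw [slice_ite p (fun η => (R : ℝ) < ‖η‖), mul_ite, mul_zero]

/-- A function in the modulation space is a smooth part plus a part of small norm. -/
theorem exists_synth_decomposition {s : ℝ} (hs : 0 ≤ s) {φ : 𝓢(Rn n, ℂ)} (hφ : φ ≠ 0)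
    {u : Rn n → ℂ} (hu : Continuous u) {C : ℝ} (hC : ∀ t, ‖u t‖ ≤ C)
    (hW : mNorm p s (stftFun φ u) < ∞) {ε : ℝ≥0∞} (hε : ε ≠ 0) (N : ℕ) :
    ∃ (b : Rn n → ℂ) (V : Rn n × Rn n → ℂ), Measurable V ∧ mNorm p s V < ∞ ∧ mNorm p s V ≤ ε ∧
      (∀ t, u t = b t + synth φ V t) ∧ ContDiff ℝ N b ∧
      ∃ A : ℝ, ∀ j ≤ N, ∀ t, ‖iteratedFDeriv ℝ j b t‖ ≤ A := by
  have hWm := measurable_stftFun φ hu hC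
  set W : Rn n × Rn n → ℂ := fun q => (windowConst φ)⁻¹ * stftFun φ u q with hWdef
  have hWm' : Measurable W := hWm.const_mul _
  have hWi : mNorm p s W < ∞ := by
    rw [hWdef, mNorm_const_mul]
    exact ENNReal.mul_lt_top enorm_lt_top hW
  obtain ⟨R, hR⟩ := exists_mNorm_high_frequency_le hp hpt hWm' hWi hε
  have hset : MeasurableSet {q : Rn n × Rn n | (R : ℝ) < ‖q.2‖} :=
    measurableSet_lt measurable_const measurable_snd.norm
  have hset' : MeasurableSet {q : Rn n × Rn n | ¬ (R : ℝ) < ‖q.2‖} := hset.compl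
  -- Sharp cutoff at frequency R: V carries the small tail, and L has bounded frequencies, so its
  -- synthesis is smooth.
  set V : Rn n × Rn n → ℂ := fun q => if (R : ℝ) < ‖q.2‖ then W q else 0 with hV
  set L : Rn n × Rn n → ℂ := fun q => if ¬ (R : ℝ) < ‖q.2‖ then W q else 0 with hL
  have hVm : Measurable V := Measurable.ite hset hWm' measurable_const
  have hLm : Measurable L := Measurable.ite hset' hWm' measurable_const
  have hVi : mNorm p s V < ∞ := (mNorm_ite_le p s (fun η => (R : ℝ) < ‖η‖) W).trans_lt hWi
  have hLi : mNorm p s L < ∞ := (mNorm_ite_le p s (fun η => ¬ (R : ℝ) < ‖η‖) W).trans_lt hWi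
  have hVi' := (lintegral_slice_le_mNorm p hs V).trans_lt hVi
  have hLi' := (lintegral_slice_le_mNorm p hs L).trans_lt hLi
  have hsmooth := contDiff_synth hp hpt φ hLm hLi' N (R := (1 + R) ^ N) (fun q hq => by
    have : ‖q.2‖ ≤ R := by
      by_contra h
      exact hq (if_neg (not_not.2 (not_le.1 h)))
    gcongr)
  refine ⟨synth φ L, V, hVm, hVi, hR, fun t => ?_, hsmooth⟩
  rw [synth_stftFun hp hpt hφ hu hC ((lintegral_slice_le_mNorm p hs _).trans_lt hW) t, synth, synth,
    synth, ← integral_add (integrable_synth hp hpt φ hLm hLi' t)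
    (integrable_synth hp hpt φ hVm hVi' t), ← integral_const_mul]
  congr 1; funext q
  rw [← add_mul, ← mul_assoc]
  congr 1
  simp only [hL, hV, hWdef]
  split_ifs <;> simp

/-- Analytic functions vanishing at the origin operate on functions in the modulation space. -/
theorem mNorm_stftFun_comp_lt_top {s : ℝ} (hs : 0 ≤ s) {φ : 𝓢(Rn n, ℂ)} (hφ : φ ≠ 0)
    {u : Rn n → ℂ} (hu : Continuous u) (hu0 : Filter.Tendsto u (Filter.cocompact (Rn n)) (nhds 0))
    (hW : mNorm p s (stftFun φ u) < ∞) {U : Set ℂ} {F : ℂ → ℂ} (hU : IsOpen U)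
    (huU : Set.range u ∪ {0} ⊆ U) (hF : DifferentiableOn ℂ F U) (hF0 : F 0 = 0) :
    (Continuous fun t => F (u t)) ∧ (∃ C, ∀ t, ‖F (u t)‖ ≤ C) ∧
      mNorm p s (stftFun φ fun t => F (u t)) < ∞ := by
  -- Vanishing at infinity makes the range together with 0 compact; this leaves room for a closed
  -- δ-neighbourhood inside U.
  have hK := hu0.isCompact_insert_range_of_cocompact hu
  set K := insert 0 (Set.range u) with hKdef
  have hKu : ∀ t, u t ∈ K := fun t => Set.mem_insert_of_mem _ ⟨t, rfl⟩
  have hKU : K ⊆ U := by rwa [hKdef, Set.insert_eq, Set.union_comm]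
  have hcF : Continuous fun t => F (u t) := hF.continuousOn.comp_continuous hu fun t => hKU (hKu t)
  obtain ⟨CF, hCF⟩ := hK.exists_bound_of_continuousOn (hF.continuousOn.mono hKU)
  obtain ⟨Cu, hCu'⟩ := hK.exists_bound_of_continuousOn continuousOn_id
  have hCu : ∀ t, ‖u t‖ ≤ Cu := fun t => hCu' _ (hKu t)
  refine ⟨hcF, ⟨CF, fun t => hCF _ (hKu t)⟩, ?_⟩
  obtain ⟨δ, hδ, hδU⟩ := hK.exists_cthickening_subset_open hU hKU
  -- F(z) = z G(z) because F(0) = 0, which puts a factor u in every term of the Taylor series.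
  set G := dslope F 0 with hGdef
  have hG : DifferentiableOn ℂ G U :=
    (Complex.differentiableOn_dslope (hU.mem_nhds (hKU (Set.mem_insert _ _)))).2 hF
  have hFG : ∀ z, F z = z * G z := fun z => by
    have := sub_smul_dslope F 0 z
    rw [hF0, sub_zero, sub_zero, smul_eq_mul] at this
    exact this.symm
  obtain ⟨M, hM⟩ := (hK.cthickening (r := δ)).exists_bound_of_continuousOn
    (hG.continuousOn.mono hδU)
  -- With |b - u| ≤ ρ/4, the closed ball of radius ρ about b(t) lies within 5ρ/4 < δ of u(t).
  set ρ := δ / 2 with hρdef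
  have hρ : 0 < ρ := by positivity
  obtain ⟨C₁, hC₁, hsup⟩ := exists_enorm_synth_le (n := n) hp hpt φ
  obtain ⟨C₂, hC₂, hmul⟩ := exists_mNorm_mul_synth_le (n := n) hp hpt hs hφ
  obtain ⟨C₃, hC₃, hsm⟩ := exists_mNorm_mul_contDiff_le (n := n) hp hpt hs hφ
    (Nat.lt_succ_self (n + ⌈s⌉₊))
  set N := (n + ⌈s⌉₊).succ
  have hD0 : 1 + C₁ + C₂ ≠ 0 := by simp
  have hDt : 1 + C₁ + C₂ ≠ ∞ := by
    simp [hC₁.ne, hC₂.ne]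
  -- A norm at most ε makes both the supremum of v and the multiplication cost C₂ ‖V‖ at most ρ/4;
  -- the summand 1 keeps the denominator nonzero.
  set ε := ENNReal.ofReal (ρ / 4) / (1 + C₁ + C₂) with hε
  have hε0 : ε ≠ 0 := ENNReal.div_ne_zero.2 ⟨by simpa using hρ, hDt⟩
  have hεD : (1 + C₁ + C₂) * ε = ENNReal.ofReal (ρ / 4) := ENNReal.mul_div_cancel hD0 hDt
  obtain ⟨b, V, hV, hVi, hVε, hbV, hbN, A, hA⟩ :=
    exists_synth_decomposition hp hpt hs hφ hu hCu hW hε0 N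
  have hVi' := (lintegral_slice_le_mNorm p hs V).trans_lt hVi
  have hvc := continuous_synth hp hpt φ hV hVi'
  have hva : ∀ t, ‖synth φ V t‖ ≤ ρ / 4 := by
    intro t
    have h1 : ‖synth φ V t‖ₑ ≤ ENNReal.ofReal (ρ / 4) := by
      rw [← hεD]
      refine (hsup V hV t).trans (mul_le_mul' ?_ ((lintegral_slice_le_mNorm p hs V).trans hVε))
      calc C₁ ≤ C₁ + (1 + C₂) := le_self_add
        _ = _ := by ring
    rw [← ofReal_norm] at h1
    exact (ENNReal.ofReal_le_ofReal_iff (by positivity)).1 h1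
  have hCV : C₂ * mNorm p s V ≤ ENNReal.ofReal (ρ / 4) := by
    rw [← hεD]
    exact mul_le_mul' le_add_self hVε
  have hball : ∀ t, Metric.closedBall (b t) ρ ⊆ Metric.cthickening δ K := by
    intro t w hw
    refine Metric.mem_cthickening_of_dist_le w (u t) δ K (hKu t) ?_
    have h1 : dist (b t) (u t) ≤ ρ / 4 := by
      rw [hbV t, dist_self_add_right]; exact hva t
    have h2 := dist_triangle w (b t) (u t)
    have h3 := Metric.mem_closedBall.1 hw
    linarith
  obtain ⟨B, hB⟩ := exists_taylorCoeff_comp_le hU hG hρ (fun t => (hball t).trans hδU)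
    (fun t w hw => hM w (hball t hw)) hbN hA
  set a : ℕ → Rn n → ℂ := fun k t => (k.factorial : ℂ)⁻¹ * iteratedDeriv k G (b t) with ha
  set g : ℕ → Rn n → ℂ := fun k t => u t * synth φ V t ^ k with hg
  have hgc : ∀ k, Continuous (g k) := fun k => hu.mul (hvc.pow k)
  have hgb : ∀ k t, ‖g k t‖ ≤ Cu * (ρ / 4) ^ k := fun k t => by
    rw [hg, norm_mul, norm_pow]
    exact mul_le_mul (hCu t) (pow_le_pow_left₀ (norm_nonneg _) (hva t) k) (by positivity)
      ((norm_nonneg _).trans (hCu t))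
  have hgm : ∀ k, mNorm p s (stftFun φ (g k)) ≤
      ENNReal.ofReal (ρ / 4) ^ k * mNorm p s (stftFun φ u) :=
    mNorm_mul_synth_pow_le hmul hV hVi hCV hvc hva hu hCu hW
  have hgf : ∀ k, mNorm p s (stftFun φ (g k)) < ∞ := fun k => (hgm k).trans_lt
    (ENNReal.mul_lt_top (ENNReal.pow_lt_top ENNReal.ofReal_lt_top) hW)
  have hB0 : 0 ≤ B := by
    have := (norm_nonneg _).trans ((hB 0).2 0 (Nat.zero_le _) 0)
    simpa using this
  -- The growth of the Taylor coefficients is beaten by the smallness of vᵏ, with ratio 1/2.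
  have hhalf : ∀ k : ℕ, (2 / ρ) ^ k * (ρ / 4) ^ k = (1 / 2 : ℝ) ^ k := fun k => by
    rw [← mul_pow]; congr 1; field_simp; norm_num
  have hac : ∀ k, Continuous (a k) := fun k => (hB k).1.continuous
  have hab : ∀ k t, ‖a k t‖ ≤ B * (2 / ρ) ^ k := fun k t => by
    have := (hB k).2 0 (Nat.zero_le _) t
    rwa [norm_iteratedFDeriv_zero] at this
  have hhc : ∀ k, Continuous fun t => g k t * a k t := fun k => (hgc k).mul (hac k)
  have hhb : ∀ k t, ‖g k t * a k t‖ ≤ Cu * B * (1 / 2) ^ k := fun k t => by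
    rw [norm_mul]
    calc _ ≤ Cu * (ρ / 4) ^ k * (B * (2 / ρ) ^ k) := mul_le_mul (hgb k t) (hab k t) (norm_nonneg _)
          ((norm_nonneg _).trans (hgb k t))
      _ = Cu * B * ((2 / ρ) ^ k * (ρ / 4) ^ k) := by ring
      _ = _ := by rw [hhalf]
  -- Taylor series of G about the moving centre b(t), evaluated at u(t) = b(t) + v(t).
  have hsum : ∀ t, F (u t) = ∑' k, g k t * a k t := by
    intro t
    have hball' : Metric.ball (b t) ρ ⊆ U :=
      Metric.ball_subset_closedBall.trans ((hball t).trans hδU)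
    have hmem : u t ∈ Metric.ball (b t) ρ := by
      rw [Metric.mem_ball, hbV t, dist_self_add_left]
      linarith [hva t]
    have h1 := Complex.taylorSeries_eq_on_ball (hG.mono hball') hmem
    rw [hFG, ← h1, ← tsum_mul_left]
    congr 1; funext k
    have h2 : u t - b t = synth φ V t := by rw [hbV t]; ring
    rw [h2]
    simp only [ha, hg, smul_eq_mul]
    ring
  have hstft : ∀ q, ‖stftFun φ (fun t => F (u t)) q‖ₑ ≤ ∑' k, ‖stftFun φ (fun t => g k t * a k t) q‖ₑ := by
    intro q
    have : (fun t => F (u t)) = fun t => ∑' k, g k t * a k t := funext hsum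
    rw [this, stftFun_tsum φ hhc hhb (summable_geometric_two.mul_left _)]
    exact enorm_tsum_le_tsum_enorm
  refine (mNorm_le_tsum hp hpt (fun k => measurable_stftFun φ (hhc k) (hhb k)) hstft).trans_lt ?_
  have hterm : ∀ k, mNorm p s (stftFun φ fun t => g k t * a k t) ≤
      C₃ * ENNReal.ofReal B * mNorm p s (stftFun φ u) * (2 : ℝ≥0∞)⁻¹ ^ k := by
    intro k
    have h1 := hsm (a k) _ (hB k).1 (hB k).2 (g k) _ (hgc k) (hgb k) (hgf k)
    have h2 : ENNReal.ofReal (B * (2 / ρ) ^ k) * ENNReal.ofReal (ρ / 4) ^ k =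
        ENNReal.ofReal B * (2 : ℝ≥0∞)⁻¹ ^ k := by
      rw [← ENNReal.ofReal_pow (by positivity), ← ENNReal.ofReal_mul (by positivity), mul_assoc,
        hhalf, ENNReal.ofReal_mul hB0, ENNReal.ofReal_pow (by norm_num), one_div,
        ENNReal.ofReal_inv_of_pos two_pos, ENNReal.ofReal_ofNat]
    calc _ ≤ _ := h1
      _ ≤ C₃ * ENNReal.ofReal (B * (2 / ρ) ^ k) *
          (ENNReal.ofReal (ρ / 4) ^ k * mNorm p s (stftFun φ u)) := by gcongr; exact hgm k
      _ = C₃ * mNorm p s (stftFun φ u) *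
          (ENNReal.ofReal (B * (2 / ρ) ^ k) * ENNReal.ofReal (ρ / 4) ^ k) := by ring
      _ = _ := by rw [h2]; ring
  refine (ENNReal.tsum_le_tsum hterm).trans_lt ?_
  rw [ENNReal.tsum_mul_left]
  refine ENNReal.mul_lt_top (ENNReal.mul_lt_top (ENNReal.mul_lt_top hC₃ ENNReal.ofReal_lt_top) hW) ?_
  rw [ENNReal.tsum_geometric]
  simp

end Composition

/-! ### Comparison of the weights and of the two frequency normalisations -/

section Normalisation

variable {n : ℕ}

theorem one_le_bracket (x : Rn n) : 1 ≤ bracket x :=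
  Real.one_le_sqrt.2 (le_add_of_nonneg_right (sq_nonneg _))

theorem norm_le_bracket (x : Rn n) : ‖x‖ ≤ bracket x :=
  Real.le_sqrt_of_sq_le (by linarith)

theorem bracket_le (x : Rn n) : bracket x ≤ 1 + ‖x‖ :=
  (Real.sqrt_le_left (by positivity)).2 (by nlinarith [norm_nonneg x])

theorem one_add_enorm (x : Rn n) : 1 + ‖x‖ₑ = ENNReal.ofReal (1 + ‖x‖) := by
  rw [ENNReal.ofReal_add zero_le_one (norm_nonneg _), ENNReal.ofReal_one, ofReal_norm]

theorem one_le_two_mul_pi : 1 ≤ 2 * Real.pi := by linarith [Real.pi_gt_three]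

theorem ofReal_bracket_rpow_le {s : ℝ} (hs : 0 ≤ s) (η : Rn n) :
    ENNReal.ofReal (bracket ((2 * Real.pi) • η) ^ s) ≤
      ENNReal.ofReal (2 * Real.pi) ^ s * wt s η := by
  have h1 := bracket_le ((2 * Real.pi) • η)
  rw [norm_smul, Real.norm_of_nonneg (by positivity)] at h1
  have hb : 0 ≤ bracket ((2 * Real.pi) • η) := zero_le_one.trans (one_le_bracket _)
  rw [← ENNReal.ofReal_rpow_of_nonneg hb hs, wt, ← ENNReal.mul_rpow_of_nonneg _ _ hs,
    one_add_enorm, ← ENNReal.ofReal_mul (by positivity)]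
  refine ENNReal.rpow_le_rpow (ENNReal.ofReal_le_ofReal ?_) hs
  linarith [one_le_two_mul_pi]

theorem wt_le_ofReal_bracket_rpow {s : ℝ} (hs : 0 ≤ s) (η : Rn n) :
    wt s η ≤ ENNReal.ofReal 2 ^ s * ENNReal.ofReal (bracket ((2 * Real.pi) • η) ^ s) := by
  have h1 := one_le_bracket ((2 * Real.pi) • η)
  have h2 := norm_le_bracket ((2 * Real.pi) • η)
  rw [norm_smul, Real.norm_of_nonneg (by positivity)] at h2
  rw [← ENNReal.ofReal_rpow_of_nonneg (zero_le_one.trans h1) hs, wt,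
    ← ENNReal.mul_rpow_of_nonneg _ _ hs, one_add_enorm, ← ENNReal.ofReal_mul (by positivity)]
  refine ENNReal.rpow_le_rpow (ENNReal.ofReal_le_ofReal ?_) hs
  nlinarith [one_le_two_mul_pi, norm_nonneg η]

theorem lintegral_comp_two_pi_smul {h : Rn n → ℝ≥0∞} (hh : Measurable h) :
    ∫⁻ η, h ((2 * Real.pi) • η) =
      ENNReal.ofReal |((2 * Real.pi) ^ Module.finrank ℝ (Rn n))⁻¹| * ∫⁻ ξ, h ξ := by
  have h2 : (2 * Real.pi) ≠ 0 := by positivity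
  rw [← lintegral_map hh (measurable_const_smul (2 * Real.pi)), Measure.map_addHaar_smul _ h2,
    lintegral_smul_measure, smul_eq_mul]

/-- The modulation space norm is finite exactly when its renormalisation `mNorm` is. -/
theorem modNorm_lt_top_iff {p : ℝ≥0∞} (hp : 1 ≤ p) (hpt : p ≠ ∞) {s : ℝ} (hs : 0 ≤ s)
    (φ : 𝓢(Rn n, ℂ)) (f : 𝓢'(Rn n, ℂ)) :
    modNorm φ p 1 s f < ∞ ↔ mNorm p s (fun q => f (atom φ q)) < ∞ := by
  have hWm := measurable_distribution_atom φ f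
  have hsl : ∀ η, slice p (fun q => f (atom φ q)) η =
      eLpNorm (fun x => stft φ f x ((2 * Real.pi) • η)) p volume := fun η => rfl
  set S : Rn n → ℝ≥0∞ := fun ξ => eLpNorm (fun x => stft φ f x ξ) p volume with hS
  have hSm : Measurable S := by
    have : S = fun ξ => slice p (fun q => f (atom φ q)) ((2 * Real.pi)⁻¹ • ξ) := by
      funext ξ
      rw [hsl, smul_smul, mul_inv_cancel₀ (by positivity), one_smul]
    rw [this]
    exact (measurable_slice hp hpt hWm).comp (measurable_const_smul _)
  have hbm : Measurable fun ξ : Rn n => ENNReal.ofReal (bracket ξ ^ s) := by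
    unfold bracket
    exact ((((measurable_norm.pow_const 2).const_add 1).sqrt).pow_const s).ennreal_ofReal
  have hbS : Measurable fun ξ => ENNReal.ofReal (bracket ξ ^ s) * S ξ := hbm.mul hSm
  set c := ENNReal.ofReal |((2 * Real.pi) ^ Module.finrank ℝ (Rn n))⁻¹| with hc
  have hc0 : c ≠ 0 := by
    rw [hc, Ne, ENNReal.ofReal_eq_zero, not_le]
    positivity
  have hmod : modNorm φ p 1 s f = ∫⁻ ξ, ENNReal.ofReal (bracket ξ ^ s) * S ξ := by
    rw [modNorm, eLpNorm_one_eq_lintegral_enorm]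
    simp only [enorm_eq_self, hS]
  -- Substitution ξ = 2πη; the weights are then comparable up to constants depending only on s.
  have hI : ∫⁻ η : Rn n, ENNReal.ofReal (bracket ((2 * Real.pi) • η) ^ s) *
      S ((2 * Real.pi) • η) = c * modNorm φ p 1 s f := by
    rw [hmod, lintegral_comp_two_pi_smul hbS]
  have hfin : ∀ r : ℝ, ENNReal.ofReal r ^ s < ∞ := fun r =>
    ENNReal.rpow_lt_top_of_nonneg hs ENNReal.ofReal_ne_top
  constructor
  · intro h
    have h1 : mNorm p s (fun q => f (atom φ q)) ≤
        ENNReal.ofReal 2 ^ s * (c * modNorm φ p 1 s f) := by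
      rw [← hI, ← lintegral_const_mul' _ _ (hfin 2).ne]
      refine lintegral_mono fun η => ?_
      rw [← mul_assoc]
      exact mul_le_mul' (wt_le_ofReal_bracket_rpow hs η) le_rfl
    exact h1.trans_lt (ENNReal.mul_lt_top (hfin 2) (ENNReal.mul_lt_top ENNReal.ofReal_lt_top h))
  · intro h
    have h1 : c * modNorm φ p 1 s f ≤
        ENNReal.ofReal (2 * Real.pi) ^ s * mNorm p s (fun q => f (atom φ q)) := by
      rw [← hI, mNorm, ← lintegral_const_mul' _ _ (hfin _).ne]
      refine lintegral_mono fun η => ?_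
      rw [← mul_assoc]
      exact mul_le_mul' (ofReal_bracket_rpow_le hs η) le_rfl
    exact ENNReal.lt_top_of_mul_ne_top_right
      (h1.trans_lt (ENNReal.mul_lt_top (hfin _) h)).ne hc0

end Normalisation

end ModulationSpace

theorem mainTheorem9 (n : ℕ) (φ : 𝓢(ModulationSpace.Rn n, ℂ)) (hφ : φ ≠ 0)
    (p : ℝ≥0∞) (hp : 1 ≤ p) (hp_top : p ≠ ∞) (s : ℝ) (hs : 0 ≤ s)
    (f : 𝓢'(ModulationSpace.Rn n, ℂ)) (hf : f ∈ ModulationSpace.modulationSpace φ p 1 s) :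
    (∃! u : ModulationSpace.Rn n → ℂ, ModulationSpace.IsContinuousFunction f u) ∧
    ∀ u : ModulationSpace.Rn n → ℂ, ModulationSpace.IsContinuousFunction f u →
      ∀ (U : Set ℂ) (F : ℂ → ℂ), IsOpen U → Set.range u ∪ {0} ⊆ U →
        AnalyticOnNhd ℂ F U → F 0 = 0 →
        ∃ g ∈ ModulationSpace.modulationSpace φ p 1 s,
          ModulationSpace.IsContinuousFunction g (fun x => F (u x)) := by
  have hfm := (ModulationSpace.modNorm_lt_top_iff hp hp_top hs φ f).1 hf
  have hfi := (ModulationSpace.lintegral_slice_le_mNorm p hs _).trans_lt hfm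
  have hmeas := ModulationSpace.measurable_distribution_atom φ f
  have hu₀ := ModulationSpace.isContinuousFunction_synth hp hp_top hφ hfi
  refine ⟨⟨_, hu₀, fun v hv => hv.unique hu₀⟩, fun u hu U F hU huU hF hF0 => ?_⟩
  -- By uniqueness u is the synthesised representative, which vanishes at infinity.
  have hu0 : Filter.Tendsto u (Filter.cocompact _) (nhds 0) := by
    rw [hu.unique hu₀]
    have h1 := (ModulationSpace.tendsto_synth_cocompact hp hp_top φ hmeas hfi).const_mul
      (ModulationSpace.windowConst φ)⁻¹
    rwa [mul_zero] at h1
  rw [hu.apply_atom φ] at hfm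
  obtain ⟨hc, ⟨C, hC⟩, hm⟩ := ModulationSpace.mNorm_stftFun_comp_lt_top hp hp_top hs hφ hu.1 hu0 hfm
    hU huU hF.differentiableOn hF0
  obtain ⟨g, hg⟩ := ModulationSpace.exists_isContinuousFunction hc hC
  refine ⟨g, (ModulationSpace.modNorm_lt_top_iff hp hp_top hs φ g).2 ?_, hg⟩
  rwa [hg.apply_atom φ]
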